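/- Let $G$ be a finite solvable group. Write $\mathrm{cd}(G)$ for the set of degrees of the irreducible complex characters of $G$, let $\rho(G)$ be the set of primes dividing some member of $\mathrm{cd}(G)$, and let $\Delta(G)$ be the graph with vertex set $\rho(G)$ in which two distinct primes $p,q$ are adjacent if $pq$ divides some member of $\mathrm{cd}(G)$. Let $N\trianglelefteq G$ be such that $\rho(G/N)=\rho(G)$. Assume that $\bar G=G/N$ has the following structure: $\bar G$ is the semidirect product of a subgroup $H$ acting on an elementary abelian $p$-group $V$ for some prime $p$; and, with $Z=C_H(V)$, $K$ the Fitting subgroup of $H$ and $m=|H:K|$, we have $m>1$, $|V|=q^m$ where $q$ is a power of $p$, $Z\subseteq Z(H)$, $K/Z$ is abelian, $K$ acts irreducibly on $V$, $m$ and $|K:Z|$ are relatively prime, and $(q^m-1)/(q-1)$ divides $|K:Z|$. Assume further that $p_1\neq p_2$ are primes in $\rho(G)$ such that $\Delta(G/N)$ has exactly two connected components, with vertex sets $\{p_1,p_2\}$ and $\rho(G)\setminus\{p_1,p_2\}$. If $p_1$ and $p_2$ both have degree two in $\Delta(G)$, and no vertex of $\Delta(G)$ is adjacent to both $p_1$ and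 $p_2$, then $N=1$. -/

import Mathlib

namespace DegreeGraph

/-- `Irr(G)`: the characters of the irreducible complex representations of `G` of finite dimension.
Up to isomorphism these representations live on the spaces `ℂⁿ`. -/
def irr (G : Type*) [Group G] : Set (G → ℂ) :=
  {χ | ∃ (n : ℕ) (σ : Representation ℂ G (Fin n → ℂ)), σ.IsIrreducible ∧ χ = σ.character}

/-- `cd(G) = {χ(1) ∣ χ ∈ Irr(G)}`, as a set of natural numbers. -/
def cd (G : Type*) [Group G] : Set ℕ :=
  {d | ∃ χ ∈ irr G, χ 1 = (d : ℂ)}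

/-- `ρ(G)`: the primes that divide some degree in `cd(G)`. -/
def rho (G : Type*) [Group G] : Set ℕ :=
  {p | p.Prime ∧ ∃ a ∈ cd G, p ∣ a}

/-- `Δ(G)`: the graph on `ρ(G)` in which distinct `p`, `q` are adjacent when `p * q` divides
some degree in `cd(G)`. -/
def degreeGraph (G : Type*) [Group G] : SimpleGraph (rho G) where
  Adj p q := p ≠ q ∧ ∃ a ∈ cd G, (p : ℕ) * (q : ℕ) ∣ a
  symm := ⟨fun p q h => ⟨h.1.symm, by
    obtain ⟨a, ha, hd⟩ := h.2
    exact ⟨a, ha, by rwa [mul_comm]⟩⟩⟩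
  loopless := ⟨fun _ h => h.1 rfl⟩

/-- The vertex sets of the connected components of `Δ(G)`, as sets of primes. -/
def components (G : Type*) [Group G] : Set (Set ℕ) :=
  Set.range fun c : (degreeGraph G).ConnectedComponent => Subtype.val '' c.supp

/-- The Fitting subgroup of a finite group: the subgroup generated by all nilpotent normal
subgroups (for a finite group, the largest nilpotent normal subgroup). -/
def fitting (H : Type*) [Group H] : Subgroup H :=
  sSup {M : Subgroup H | M.Normal ∧ Group.IsNilpotent M}

/-- `G` is the (internal) semidirect product of a subgroup `H` acting by conjugation on an
elementary abelian `p`-group `V`; here `Z = C_H(V)`, `K` is the Fitting subgroup of `H`,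
`m = |H : K|` and `|V| = q ^ m`. -/
structure IsSemilinearProduct {G : Type*} [Group G] (p m q : ℕ) (V H : Subgroup G)
    (Z K : Subgroup H) : Prop where
  prime : p.Prime
  normal : V.Normal
  complement : V.IsComplement' H
  comm : ∀ v ∈ V, ∀ w ∈ V, v * w = w * v
  exponent : ∀ v ∈ V, v ^ p = 1
  Z_eq : Z = (Subgroup.centralizer (V : Set G)).subgroupOf H
  K_eq : K = fitting H
  m_eq : m = K.index
  one_lt_m : 1 < m
  q_eq : ∃ f : ℕ, q = p ^ f
  card_V : Nat.card V = q ^ m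
  Z_le_center : Z ≤ Subgroup.center H
  /-- `K / Z` is abelian. -/
  quotient_comm : ⁅K, K⁆ ≤ Z
  ne_bot : V ≠ ⊥
  /-- `K` acts irreducibly on `V`. -/
  irreducible : ∀ W : Subgroup G, W ≤ V →
    (∀ k ∈ K, ∀ w ∈ W, (k : G) * w * (k : G)⁻¹ ∈ W) → W = ⊥ ∨ W = V
  coprime : m.Coprime (Z.relIndex K)
  dvd : (q ^ m - 1) / (q - 1) ∣ Z.relIndex K

/-- The groups of the semilinear type among the solvable groups whose degree graph has two
connected components. -/
def IsSemilinearType (G : Type*) [Group G] : Prop :=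
  ∃ (p m q : ℕ) (V H : Subgroup G) (Z K : Subgroup H), IsSemilinearProduct p m q V H Z K

end DegreeGraph

-- The hypotheses are contradictory, so the conclusion holds vacuously. In the quotient `V ⋊ H` the
-- primes dividing `m` occur together in one degree (`exists_degree_index`), those dividing `|K :
-- Z|` occur together in another (`exists_degree_relIndex`), and every prime of a degree is of one
-- of the two kinds (`dvd_or_dvd_of_mem_cd`). Hence `{p₁, p₂}` is the set of prime divisors of `m`
-- or of `|K : Z|`, and `p₁`, `p₂` are adjacent. In the graph of the big group each then has exactly
-- one further neighbour, `q₁` and `q₂`, and these differ because there is no common neighbour.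
--
-- The missing edges `p₁ q₂` and `p₂ q₁` restrict the action of `H / K` on `K / Z`. By
-- `commutator_mem_of_not_dvd`, if some degree is divisible by `u` but not by `s`, where `u` does
-- not divide `m`, and no degree is divisible by both `u` and `r`, then the `r`-elements of `H / K`
-- centralise the `s`-part of `K / Z`. The proof is Clifford theory with determinants: twisting a
-- module by linear characters turns invariance of determinants into invariance of the characters
-- themselves.
--
-- The structure of `V ⋊ H` forbids so much centralising. By Schur's lemma `K` generates a field `F`
-- of order `q ^ m` with `K / Z` inside the units and `H / K` acting as a cyclic group of `m` field
-- automorphisms. Write `m = x * y` with coprime factors greater than 1. If every primary part of `K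
-- / Z` is fixed by the elements of order `x` or by those of order `y`, then `K / Z` lies in the
-- product of the unit groups of two subfields of orders `q ^ y` and `q ^ x`. This is smaller than
-- `(q ^ m - 1) / (q - 1)`, which divides `|K : Z|`.

universe u

open Module
open scoped commutatorElement

/-! ### Clifford theory: simple submodules for a normal subgroup. -/

namespace Clifford

variable {G W G' W' : Type*} [Group G] [AddCommGroup W] [Module ℂ W]
  [Group G'] [AddCommGroup W'] [Module ℂ W']
  {ρ : Representation ℂ G W} {ρ' : Representation ℂ G' W'}
  {X : Subgroup G} {X' : Subgroup G'} {S T U : Submodule ℂ W}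

/-- The subspace `S` is stable under the operators of the subgroup `X`. -/
def Stable (ρ : Representation ℂ G W) (X : Subgroup G) (S : Submodule ℂ W) : Prop :=
  ∀ x ∈ X, ∀ w ∈ S, ρ x w ∈ S

/-- The subspace `S` is a simple module for the subgroup `X`. -/
structure Simple (ρ : Representation ℂ G W) (X : Subgroup G) (S : Submodule ℂ W) : Prop where
  stable : Stable ρ X S
  ne_bot : S ≠ ⊥
  eq_bot_or_eq : ∀ T ≤ S, Stable ρ X T → T = ⊥ ∨ T = S

/-- The representation of `X` on an `X`-stable subspace. -/
def Stable.subrep (hS : Stable ρ X S) : Representation ℂ X S where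
  toFun x := (ρ x).restrict (hS x x.2)
  map_one' := by ext; simp
  map_mul' x y := by ext; simp

@[simp] lemma Stable.coe_subrep_apply (hS : Stable ρ X S) (x : X) (s : S) :
    (hS.subrep x s : W) = ρ x s := rfl

lemma Stable.inf (hS : Stable ρ X S) (hT : Stable ρ X T) : Stable ρ X (S ⊓ T) :=
  fun x hx w hw => ⟨hS x hx w hw.1, hT x hx w hw.2⟩

lemma Stable.exists_simple_le [FiniteDimensional ℂ W] (hS : Stable ρ X S) (h0 : S ≠ ⊥) :
    ∃ T ≤ S, Simple ρ X T := by
  obtain ⟨T, hT⟩ := exists_minimal_of_wellFoundedLT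
    (fun T : Submodule ℂ W => T ≤ S ∧ Stable ρ X T ∧ T ≠ ⊥) ⟨S, le_rfl, hS, h0⟩
  refine ⟨T, hT.prop.1, hT.prop.2.1, hT.prop.2.2, fun T' hle hst => ?_⟩
  by_contra! h
  exact h.2 (le_antisymm hle (hT.le_of_le ⟨hle.trans hT.prop.1, hst, h.1⟩ hle))

/-- Maschke's theorem for the restriction of `ρ` to `X`. -/
lemma Stable.exists_isCompl [Finite G] (hS : Stable ρ X S) :
    ∃ T, Stable ρ X T ∧ IsCompl S T := by
  let τ : Representation ℂ X W := ρ.comp X.subtype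
  let S' : Subrepresentation τ := ⟨S, fun g v hv => hS g g.2 v hv⟩
  obtain ⟨T', hT'⟩ := ComplementedLattice.exists_isCompl S'
  refine ⟨T'.toSubmodule, fun x hx w hw => T'.apply_mem_toSubmodule ⟨x, hx⟩ hw, ?_, ?_⟩
  · rw [disjoint_iff]
    have := congrArg Subrepresentation.toSubmodule (disjoint_iff.1 hT'.1)
    exact this
  · rw [codisjoint_iff]
    have := congrArg Subrepresentation.toSubmodule (codisjoint_iff.1 hT'.2)
    exact this

lemma Stable.exists_projection [Finite G] (hS : Stable ρ X S) :
    ∃ P : W →ₗ[ℂ] W, (∀ x ∈ X, ∀ w, P (ρ x w) = ρ x (P w)) ∧ (∀ w, P w ∈ S) ∧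
      ∀ s ∈ S, P s = s := by
  obtain ⟨T, hT, hc⟩ := hS.exists_isCompl
  have key : ∀ s ∈ S, ∀ t ∈ T, S.subtype (S.projectionOnto T hc (s + t)) = s := by
    intro s hs t ht
    rw [map_add, (Submodule.projectionOnto_apply_eq_zero_iff hc).2 ht, add_zero]
    exact congrArg Subtype.val (Submodule.projectionOnto_apply_left hc ⟨s, hs⟩)
  refine ⟨S.subtype ∘ₗ S.projectionOnto T hc, fun x hx w => ?_, fun w => ?_, fun s hs => ?_⟩
  · obtain ⟨s, hs, t, ht, rfl⟩ := Submodule.mem_sup.1 (hc.sup_eq_top ▸ Submodule.mem_top (x := w))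
    simp only [LinearMap.comp_apply]
    rw [map_add, key _ (hS x hx s hs) _ (hT x hx t ht), key _ hs _ ht]
  · exact Subtype.property _
  · simpa using key s hs 0 T.zero_mem

/-- If `d` divides the dimensions of all simple submodules, it divides the total dimension. -/
lemma Stable.dvd_finrank [Finite G] [FiniteDimensional ℂ W] {d : ℕ} (hS : Stable ρ X S)
    (h : ∀ T ≤ S, Simple ρ X T → d ∣ finrank ℂ T) : d ∣ finrank ℂ S := by
  induction hn : finrank ℂ S using Nat.strong_induction_on generalizing S with
  | _ n ih =>
    subst hn
    by_cases h0 : S = ⊥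
    · rw [h0, finrank_bot]; exact dvd_zero d
    obtain ⟨T, hTS, hT⟩ := hS.exists_simple_le h0
    obtain ⟨T', hT', hc⟩ := hT.stable.exists_isCompl
    have hsup : T ⊔ (T' ⊓ S) = S := by
      rw [← sup_inf_assoc_of_le _ hTS, hc.sup_eq_top, top_inf_eq]
    have hinf : T ⊓ (T' ⊓ S) = ⊥ := by
      rw [← inf_assoc, hc.inf_eq_bot, bot_inf_eq]
    have hdim := Submodule.finrank_sup_add_finrank_inf_eq T (T' ⊓ S)
    rw [hsup, hinf, finrank_bot, add_zero] at hdim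
    have hpos : 0 < finrank ℂ T := by
      rw [Nat.pos_iff_ne_zero, Ne, Submodule.finrank_eq_zero]
      exact hT.ne_bot
    rw [hdim]
    exact dvd_add (h T hTS hT) (ih _ (by omega) (hT'.inf hS)
      (fun R hR => h R (hR.trans inf_le_right)) rfl)

/-- Schur's lemma for maps that are equivariant up to scalars. -/
lemma Simple.map (hU : Simple ρ X U) (f : W →ₗ[ℂ] W')
    (h₁ : ∀ x ∈ X, ∃ x' ∈ X', ∃ c : ℂ, ∀ u ∈ U, f (ρ x u) = c • ρ' x' (f u))
    (h₂ : ∀ x' ∈ X', ∃ x ∈ X, ∃ c : ℂ, ∀ u ∈ U, ρ' x' (f u) = c • f (ρ x u)) :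
    (∀ u ∈ U, f u = 0) ∨ ((∀ u ∈ U, f u = 0 → u = 0) ∧ Simple ρ' X' (U.map f)) := by
  have hker : Stable ρ X (U ⊓ LinearMap.ker f) := by
    rintro x hx w ⟨hw, hw'⟩
    obtain ⟨x', -, c, hc⟩ := h₁ x hx
    refine ⟨hU.stable x hx w hw, ?_⟩
    rw [SetLike.mem_coe, LinearMap.mem_ker] at hw' ⊢
    rw [hc w hw, hw', map_zero, smul_zero]
  rcases hU.eq_bot_or_eq _ inf_le_left hker with h | h
  · have hinj : ∀ u ∈ U, f u = 0 → u = 0 := fun u hu hf => by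
      have : u ∈ U ⊓ LinearMap.ker f := ⟨hu, hf⟩
      rwa [h, Submodule.mem_bot] at this
    refine Or.inr ⟨hinj, ?_, ?_, ?_⟩
    · rintro x' hx' _ ⟨u, hu, rfl⟩
      obtain ⟨x, hx, c, hc⟩ := h₂ x' hx'
      rw [hc u hu]
      exact Submodule.smul_mem _ _ ⟨_, hU.stable x hx u hu, rfl⟩
    · intro h0
      apply hU.ne_bot
      rw [Submodule.eq_bot_iff]
      intro u hu
      apply hinj u hu
      have : f u ∈ U.map f := ⟨u, hu, rfl⟩
      rwa [h0, Submodule.mem_bot] at this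
    · intro T hT hst
      have hT' : Stable ρ X (U ⊓ T.comap f) := by
        rintro x hx w ⟨hw, hw'⟩
        obtain ⟨x', hx', c, hc⟩ := h₁ x hx
        refine ⟨hU.stable x hx w hw, ?_⟩
        rw [SetLike.mem_coe, Submodule.mem_comap] at hw' ⊢
        rw [hc w hw]
        exact T.smul_mem _ (hst x' hx' _ hw')
      have heq : T = (U ⊓ T.comap f).map f := by
        refine le_antisymm (fun t ht => ?_) ?_
        · obtain ⟨u, hu, rfl⟩ := hT ht
          exact ⟨u, ⟨hu, ht⟩, rfl⟩
        · rintro _ ⟨u, hu, rfl⟩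
          exact hu.2
      rcases hU.eq_bot_or_eq _ inf_le_left hT' with h' | h'
      · left; rw [heq, h', Submodule.map_bot]
      · right; rw [heq, h']
  · left
    intro u hu
    rw [← h] at hu
    exact hu.2

lemma finrank_map_eq (f : W →ₗ[ℂ] W') (hf : ∀ u ∈ U, f u = 0 → u = 0) :
    finrank ℂ (U.map f) = finrank ℂ U := by
  rw [← LinearMap.range_domRestrict]
  refine LinearMap.finrank_range_of_inj ?_
  rw [← LinearMap.ker_eq_bot, LinearMap.ker_eq_bot']
  rintro ⟨u, hu⟩ h
  exact Subtype.ext (hf u hu h)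

lemma Simple.congr (hU : Simple ρ X U) (f : W →ₗ[ℂ] W') (hf : ∀ u ∈ U, f u = 0 → u = 0)
    (h₁ : ∀ x ∈ X, ∃ x' ∈ X', ∃ c : ℂ, ∀ u ∈ U, f (ρ x u) = c • ρ' x' (f u))
    (h₂ : ∀ x' ∈ X', ∃ x ∈ X, ∃ c : ℂ, ∀ u ∈ U, ρ' x' (f u) = c • f (ρ x u)) :
    Simple ρ' X' (U.map f) := by
  rcases hU.map f h₁ h₂ with h | h
  · exact absurd ((Submodule.eq_bot_iff _).2 fun u hu => hf u hu (h u hu)) hU.ne_bot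
  · exact h.2

/-- The simple submodules for a normal subgroup of an irreducible module are conjugate. -/
lemma Simple.exists_conj [Finite G] [X.Normal] (hW : Simple ρ ⊤ ⊤)
    (hU : Simple ρ X U) (hT : Simple ρ X T) :
    ∃ (g : G) (f : W →ₗ[ℂ] W), (∀ x ∈ X, ∀ u ∈ U, f (ρ (g⁻¹ * x * g) u) = ρ x (f u)) ∧
      (∀ u ∈ U, f u = 0 → u = 0) ∧ U.map f = T := by
  obtain ⟨P, hP, hPT, hPid⟩ := hT.stable.exists_projection
  -- Otherwise the common kernel of all `P ∘ₗ ρ g` is a submodule stable under `G` that contains `U`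
  -- and, by the case `g = 1`, meets `T` only in zero.
  have hex : ∃ g, ∃ u ∈ U, P (ρ g u) ≠ 0 := by
    by_contra! h
    have hst : Stable ρ ⊤ (⨅ g, LinearMap.ker (P ∘ₗ ρ g)) := by
      intro x _ w hw
      rw [Submodule.mem_iInf] at hw ⊢
      intro g
      have := hw (g * x)
      simpa [LinearMap.mem_ker] using this
    rcases hW.eq_bot_or_eq _ le_top hst with h' | h'
    · refine hU.ne_bot (le_bot_iff.1 ?_)
      rw [← h']
      intro u hu
      rw [Submodule.mem_iInf]
      exact fun g => h g u hu
    · refine hT.ne_bot ((Submodule.eq_bot_iff _).2 fun t ht => ?_)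
      have : t ∈ ⨅ g, LinearMap.ker (P ∘ₗ ρ g) := h' ▸ Submodule.mem_top
      rw [Submodule.mem_iInf] at this
      have := this 1
      simpa [LinearMap.mem_ker, hPid t ht] using this
  obtain ⟨g, u₀, hu₀, hne⟩ := hex
  have heq : ∀ x ∈ X, ∀ u ∈ U, (P ∘ₗ ρ g) (ρ (g⁻¹ * x * g) u) = ρ x ((P ∘ₗ ρ g) u) := by
    intro x hx u _
    have : ρ g (ρ (g⁻¹ * x * g) u) = ρ x (ρ g u) := by
      rw [← Module.End.mul_apply, ← map_mul, ← Module.End.mul_apply, ← map_mul]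
      congr 2
      group
    rw [LinearMap.comp_apply, this, hP x hx, LinearMap.comp_apply]
  refine ⟨g, P ∘ₗ ρ g, heq, ?_⟩
  have hmap := hU.map (ρ' := ρ) (X' := X) (P ∘ₗ ρ g) (fun x hx => ?_) (fun x hx => ?_)
  · rcases hmap with h | h
    · exact absurd (h u₀ hu₀) hne
    · refine ⟨h.1, ?_⟩
      refine (hT.eq_bot_or_eq _ ?_ h.2.stable).resolve_left h.2.ne_bot
      rintro _ ⟨u, -, rfl⟩
      exact hPT _
  · refine ⟨g * x * g⁻¹, ‹X.Normal›.conj_mem x hx g, 1, fun u hu => ?_⟩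
    rw [← heq _ (‹X.Normal›.conj_mem x hx g) u hu, one_smul]
    congr 3
    group
  · refine ⟨g⁻¹ * x * g, by simpa using ‹X.Normal›.conj_mem x hx g⁻¹, 1, fun u hu => ?_⟩
    rw [heq x hx u hu, one_smul]

lemma Simple.finrank_eq [Finite G] [X.Normal] (hW : Simple ρ ⊤ ⊤)
    (hU : Simple ρ X U) (hT : Simple ρ X T) : finrank ℂ T = finrank ℂ U := by
  obtain ⟨g, f, -, hf, rfl⟩ := hW.exists_conj hU hT
  exact finrank_map_eq f hf

lemma Simple.finrank_dvd [Finite G] [FiniteDimensional ℂ W] [X.Normal] (hW : Simple ρ ⊤ ⊤)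
    (hU : Simple ρ X U) : finrank ℂ U ∣ finrank ℂ W := by
  rw [← finrank_top ℂ W]
  exact Stable.dvd_finrank (ρ := ρ) (X := X) (fun _ _ _ _ => Submodule.mem_top)
    fun T _ hT => (hW.finrank_eq hU hT).symm.dvd

end Clifford

/-! ### Dimensions over a normal subgroup with abelian quotient. -/

namespace Clifford

variable {G W : Type*} [Group G] [AddCommGroup W] [Module ℂ W]
  {ρ : Representation ℂ G W} {X : Subgroup G} {S T U : Submodule ℂ W}

/-- A function on a finite abelian group with vanishing Fourier transform vanishes. -/
lemma eq_zero_of_fourier_eq_zero {Q : Type*} [CommGroup Q] [Fintype Q] (f : Q → W)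
    (h : ∀ χ : AddChar (Additive Q) ℂ, ∑ c : Q, χ (Additive.ofMul c) • f c = 0) : f = 0 := by
  classical
  funext c₀
  have h1 : ∑ χ : AddChar (Additive Q) ℂ,
      χ (Additive.ofMul c₀⁻¹) • ∑ c : Q, χ (Additive.ofMul c) • f c = 0 :=
    Finset.sum_eq_zero fun χ _ => by rw [h χ, smul_zero]
  simp_rw [Finset.smul_sum, smul_smul, ← AddChar.map_add_eq_mul] at h1
  rw [Finset.sum_comm] at h1
  simp_rw [← Finset.sum_smul, AddChar.sum_apply_eq_ite] at h1
  have h2 : ∀ c : Q, (Additive.ofMul c₀⁻¹ + Additive.ofMul c = 0) ↔ c = c₀ := by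
    intro c
    rw [← ofMul_mul, ofMul_eq_zero, inv_mul_eq_one, eq_comm]
  simp_rw [h2, ite_smul, zero_smul, Finset.sum_ite_eq', Finset.mem_univ, if_true] at h1
  refine (smul_eq_zero.1 h1).resolve_left ?_
  exact Nat.cast_ne_zero.2 Fintype.card_ne_zero

/-- The representation of `G` on the functions from a quotient of `G` to a representation. -/
def quotientFun {Q : Type*} [Group Q] (π : G →* Q) (ρ : Representation ℂ G W) :
    Representation ℂ G (Q → W) where
  toFun g :=
    { toFun := fun f c => ρ g (f ((π g)⁻¹ * c))
      map_add' := fun f f' => by ext; simp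
      map_smul' := fun a f => by ext; simp }
  map_one' := by ext; simp
  map_mul' g h := by ext; simp [mul_assoc]

lemma quotientFun_apply {Q : Type*} [Group Q] (π : G →* Q) (g : G) (f : Q → W) (c : Q) :
    quotientFun π ρ g f c = ρ g (f ((π g)⁻¹ * c)) := rfl

/-- Each Fourier coefficient is a map to `W` that is equivariant up to the scalars `χ (π g)`. Some
coefficient does not vanish on `R`, and by Schur's lemma up to scalars it is then an isomorphism
onto `W`. -/
lemma Simple.finrank_of_quotientFun [FiniteDimensional ℂ W]
    {Q : Type*} [CommGroup Q] [Finite Q] {π : G →* Q} (hW : Simple ρ ⊤ ⊤)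
    {R : Submodule ℂ (Q → W)} (hR : Simple (quotientFun π ρ) ⊤ R) :
    finrank ℂ R = finrank ℂ W := by
  have := Fintype.ofFinite Q
  let Φ (χ : AddChar (Additive Q) ℂ) : (Q → W) →ₗ[ℂ] W :=
    ∑ c : Q, χ (Additive.ofMul c) • LinearMap.proj c
  have hΦ : ∀ χ f, Φ χ f = ∑ c : Q, χ (Additive.ofMul c) • f c := fun χ f => by
    simp [Φ]
  have hequiv : ∀ χ g f, Φ χ (quotientFun π ρ g f) = χ (Additive.ofMul (π g)) • ρ g (Φ χ f) := by
    intro χ g f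
    rw [hΦ, hΦ, map_sum, Finset.smul_sum, ← Equiv.sum_comp (Equiv.mulLeft (π g))]
    refine Finset.sum_congr rfl fun c _ => ?_
    rw [quotientFun_apply, Equiv.coe_mulLeft, inv_mul_cancel_left, map_smul, smul_smul, ofMul_mul,
      AddChar.map_add_eq_mul]
  obtain ⟨χ, f, hf, hne⟩ : ∃ χ, ∃ f ∈ R, Φ χ f ≠ 0 := by
    by_contra! h
    refine hR.ne_bot ((Submodule.eq_bot_iff _).2 fun f hf => eq_zero_of_fourier_eq_zero f ?_)
    exact fun χ => (hΦ χ f).symm.trans (h χ f hf)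
  have hχ : ∀ g, χ (Additive.ofMul (π g)) ≠ 0 := fun g => (χ.val_isUnit _).ne_zero
  have hmap := hR.map (ρ' := ρ) (X' := ⊤) (Φ χ)
    (fun g _ => ⟨g, Subgroup.mem_top g, _, fun u _ => hequiv χ g u⟩)
    (fun g _ => ⟨g, Subgroup.mem_top g, (χ (Additive.ofMul (π g)))⁻¹, fun u _ => by
      rw [hequiv, smul_smul, inv_mul_cancel₀ (hχ g), one_smul]⟩)
  rcases hmap with h | h
  · exact absurd (h f hf) hne
  · rw [← finrank_map_eq _ h.1,
      (hW.eq_bot_or_eq _ le_top h.2.stable).resolve_left h.2.ne_bot, finrank_top]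

/-- The module induced from `U` has dimension `|Q| dim U` and embeds in the functions `Q → W`, all
of whose simple submodules have dimension `dim W`. -/
lemma Simple.finrank_dvd_card_mul [Finite G] [FiniteDimensional ℂ W]
    {Q : Type*} [CommGroup Q] {π : G →* Q} (hπ : Function.Surjective π)
    (hW : Simple ρ ⊤ ⊤) (hU : Stable ρ π.ker U) :
    finrank ℂ W ∣ Nat.card Q * finrank ℂ U := by
  have : Finite Q := Finite.of_surjective π hπ
  have := Fintype.ofFinite Q
  obtain ⟨s, hs⟩ := hπ.hasRightInverse
  -- The range of `F` is a copy of the induced module: the functions whose value at `c` lies in the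
  -- translate of `U` by `s c`.
  let F : (Q → U) →ₗ[ℂ] (Q → W) :=
    { toFun := fun f c => ρ (s c) (f c)
      map_add' := fun f f' => by ext; simp
      map_smul' := fun a f => by ext; simp }
  have hF : Function.Injective F := by
    intro f f' h
    funext c
    have := congrFun h c
    refine Subtype.ext ?_
    have h2 := congrArg (ρ (s c)⁻¹) this
    simpa [F] using h2
  have hstab : Stable (quotientFun π ρ) ⊤ (LinearMap.range F) := by
    rintro g - _ ⟨f, rfl⟩
    have hmem : ∀ c, (s c)⁻¹ * g * s ((π g)⁻¹ * c) ∈ π.ker := fun c => by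
      rw [MonoidHom.mem_ker, map_mul, map_mul, map_inv, hs, hs]
      group
    refine ⟨fun c => ⟨ρ ((s c)⁻¹ * g * s ((π g)⁻¹ * c)) (f ((π g)⁻¹ * c)),
      hU _ (hmem c) _ (f _).2⟩, ?_⟩
    funext c
    change ρ (s c) (ρ _ _) = ρ g (ρ _ _)
    rw [← Module.End.mul_apply, ← map_mul, ← Module.End.mul_apply, ← map_mul]
    congr 2
    group
  have hdim : finrank ℂ (LinearMap.range F) = Nat.card Q * finrank ℂ U := by
    rw [LinearMap.finrank_range_of_inj hF, Module.finrank_pi_fintype, Finset.sum_const,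
      Finset.card_univ, Nat.card_eq_fintype_card, smul_eq_mul]
  rw [← hdim]
  exact hstab.dvd_finrank fun R _ hR => (hW.finrank_of_quotientFun hR).symm.dvd

lemma Simple.subrep (hT : Simple ρ X T) : Simple hT.stable.subrep ⊤ ⊤ := by
  obtain ⟨f, hf⟩ := LinearMap.exists_leftInverse_of_injective T.subtype T.ker_subtype
  have hf' : ∀ t : T, f t = t := fun t => LinearMap.congr_fun hf t
  have htop : T.map f = ⊤ := by
    rw [eq_top_iff]
    exact fun t _ => ⟨t, t.2, hf' t⟩
  have hx : ∀ x : X, ∀ u : W, ∀ hu : u ∈ T, f (ρ x u) = hT.stable.subrep x (f u) := by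
    intro x u hu
    rw [hf' ⟨u, hu⟩]
    exact hf' ⟨_, hT.stable x x.2 u hu⟩
  rw [← htop]
  refine hT.congr f (fun u hu h => ?_) (fun x hxX => ?_) (fun x _ => ?_)
  · rw [hf' ⟨u, hu⟩] at h
    exact congrArg Subtype.val h
  · exact ⟨⟨x, hxX⟩, Subgroup.mem_top _, 1, fun u hu => by rw [one_smul, ← hx ⟨x, hxX⟩ u hu]⟩
  · exact ⟨x, x.2, 1, fun u hu => by rw [one_smul, ← hx x u hu]⟩

/-- Let `E ≤ Y` with `Y / E` abelian. If `T` is a simple `Y`-module and `U ≤ T` a simple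
`E`-submodule, then `dim T` divides `|Y : E| dim U`. -/
lemma Simple.finrank_dvd_relIndex_mul [Finite G] [FiniteDimensional ℂ W] {E Y : Subgroup G}
    [E.Normal] (hEY : ⁅Y, Y⁆ ≤ E) (hT : Simple ρ Y T) (hU : Stable ρ E U)
    (hUT : U ≤ T) : finrank ℂ T ∣ E.relIndex Y * finrank ℂ U := by
  let Q := Y.map (QuotientGroup.mk' E)
  let _ : CommGroup Q :=
    { (inferInstance : Group Q) with
      mul_comm := by
        rintro ⟨_, a, ha, rfl⟩ ⟨_, b, hb, rfl⟩
        refine Subtype.ext ?_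
        have h : ⁅a, b⁆ ∈ E := hEY (Subgroup.commutator_mem_commutator ha hb)
        rw [← QuotientGroup.ker_mk' E, MonoidHom.mem_ker, map_commutatorElement,
          commutatorElement_eq_one_iff_mul_comm] at h
        exact h }
  let π : Y →* Q := (QuotientGroup.mk' E).subgroupMap Y
  have hπ : Function.Surjective π := (QuotientGroup.mk' E).subgroupMap_surjective Y
  have hker : ∀ y : Y, y ∈ π.ker ↔ (y : G) ∈ E := by
    intro y
    rw [MonoidHom.mem_ker, Subtype.ext_iff]
    exact QuotientGroup.eq_one_iff (y : G)
  have hcard : Nat.card Q = E.relIndex Y := by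
    rw [← Subgroup.relIndex_ker, QuotientGroup.ker_mk']
  have hdim : finrank ℂ (U.comap T.subtype) = finrank ℂ U := by
    rw [← LinearMap.finrank_range_of_inj (Submodule.inclusion_injective hUT),
      Submodule.range_inclusion]
  have := hT.subrep.finrank_dvd_card_mul hπ (U := U.comap T.subtype)
    (fun y hy t ht => hU y ((hker y).1 hy) t ht)
  rwa [hcard, hdim] at this

/-- A prime power order element modulo a normal subgroup `E`, of order prime to the dimension,
stabilises some simple `E`-submodule. -/
lemma exists_simple_stable [Finite G] [FiniteDimensional ℂ W] {E : Subgroup G} [E.Normal]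
    {r k : ℕ} (hr : r.Prime) (hW : ¬ r ∣ finrank ℂ W) {x : G} (hx : x ^ r ^ k ∈ E) :
    ∃ U, Simple ρ E U ∧ ∀ u ∈ U, ρ x u ∈ U := by
  let Y := E ⊔ Subgroup.zpowers x
  have hmap : Y.map (QuotientGroup.mk' E) = Subgroup.zpowers (QuotientGroup.mk' E x) := by
    rw [Subgroup.map_sup, QuotientGroup.map_mk'_self, bot_sup_eq, MonoidHom.map_zpowers]
  have hY : ⁅Y, Y⁆ ≤ E := by
    rw [← QuotientGroup.ker_mk' E, ← (Subgroup.map_eq_bot_iff _), Subgroup.map_commutator, hmap,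
      Subgroup.commutator_eq_bot_iff_le_centralizer]
    exact Subgroup.le_centralizer _
  have hidx : E.relIndex Y ∣ r ^ k := by
    conv_lhs => rw [← QuotientGroup.ker_mk' E]
    rw [Subgroup.relIndex_ker, hmap, Nat.card_zpowers, orderOf_dvd_iff_pow_eq_one, ← map_pow]
    exact (QuotientGroup.eq_one_iff _).2 hx
  obtain ⟨T, hT, hrT⟩ : ∃ T, Simple ρ Y T ∧ ¬ r ∣ finrank ℂ T := by
    by_contra! h
    refine hW ?_
    rw [← finrank_top ℂ W]
    exact Stable.dvd_finrank (ρ := ρ) (X := Y) (fun _ _ _ _ => Submodule.mem_top)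
      fun T _ hT => h T hT
  have hTE : Stable ρ E T := fun e he => hT.stable e (le_sup_left (a := E) he)
  obtain ⟨U, hUT, hU⟩ := hTE.exists_simple_le hT.ne_bot
  have hdvd := hT.finrank_dvd_relIndex_mul hY hU.stable hUT
  -- Since `|Y : E|` is a power of `r`, the divisibility `hdvd` forces `dim T ∣ dim U`, so `T = U`
  -- is already simple for `E`.
  have hcop : (finrank ℂ T).Coprime (E.relIndex Y) :=
    Nat.Coprime.coprime_dvd_right hidx
      (((Nat.Prime.coprime_iff_not_dvd hr).2 hrT).symm.pow_right k)
  have hle : finrank ℂ T ≤ finrank ℂ U := by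
    refine Nat.le_of_dvd ?_ (hcop.dvd_of_dvd_mul_left hdvd)
    rw [Nat.pos_iff_ne_zero, Ne, Submodule.finrank_eq_zero]
    exact hU.ne_bot
  have := Submodule.eq_of_le_of_finrank_le hUT hle
  subst this
  exact ⟨U, hU, hT.stable x (Subgroup.mem_sup_right (Subgroup.mem_zpowers x))⟩

end Clifford

/-! ### Degrees over a representation of a normal subgroup, and invariance of determinants. -/

namespace Clifford

variable {G W G' W' : Type*} [Group G] [AddCommGroup W] [Module ℂ W]
  [Group G'] [AddCommGroup W'] [Module ℂ W']
  {ρ : Representation ℂ G W} {ρ' : Representation ℂ G' W'}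
  {X : Subgroup G} {X' : Subgroup G'} {S T U : Submodule ℂ W}

lemma simple_top_iff_isIrreducible : Simple ρ ⊤ ⊤ ↔ ρ.IsIrreducible := by
  constructor
  · intro h
    have hne : (⊥ : Subrepresentation ρ) ≠ ⊤ := fun h0 =>
      h.ne_bot (congrArg Subrepresentation.toSubmodule h0).symm
    have : Nontrivial (Subrepresentation ρ) := ⟨⊥, ⊤, hne⟩
    refine ⟨fun S => ?_⟩
    rcases h.eq_bot_or_eq S.toSubmodule le_top
      (fun g _ w hw => S.apply_mem_toSubmodule g hw) with h' | h'
    · exact Or.inl (Subrepresentation.toSubmodule_injective h')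
    · exact Or.inr (Subrepresentation.toSubmodule_injective h')
  · intro h
    refine ⟨fun _ _ _ _ => Submodule.mem_top, fun h0 => ?_, fun S _ hS => ?_⟩
    · exact bot_ne_top (α := Subrepresentation ρ)
        (Subrepresentation.toSubmodule_injective h0.symm)
    · let S' : Subrepresentation ρ := ⟨S, fun g w hw => hS g (Subgroup.mem_top g) w hw⟩
      rcases eq_bot_or_eq_top S' with h' | h'
      · exact Or.inl (congrArg Subrepresentation.toSubmodule h')
      · exact Or.inr (congrArg Subrepresentation.toSubmodule h')

/-- A simple submodule is isomorphic to an irreducible representation on some `ℂⁿ`. -/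
lemma Simple.exists_model [FiniteDimensional ℂ W] (hS : Simple ρ ⊤ S) :
    ∃ (σ : Representation ℂ G (Fin (finrank ℂ S) → ℂ)) (f : W →ₗ[ℂ] (Fin (finrank ℂ S) → ℂ)),
      Simple σ ⊤ ⊤ ∧ (∀ g, ∀ s ∈ S, f (ρ g s) = σ g (f s)) ∧ ∀ s ∈ S, f s = 0 → s = 0 := by
  obtain ⟨p, hp⟩ := LinearMap.exists_leftInverse_of_injective S.subtype S.ker_subtype
  have hp' : ∀ t : S, p t = t := fun t => LinearMap.congr_fun hp t
  let e : S ≃ₗ[ℂ] (Fin (finrank ℂ S) → ℂ) := (finBasis ℂ S).equivFun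
  let σ : Representation ℂ G (Fin (finrank ℂ S) → ℂ) :=
    { toFun := fun g => e.conj (hS.stable.subrep ⟨g, Subgroup.mem_top g⟩)
      map_one' := by
        have : (⟨1, Subgroup.mem_top 1⟩ : (⊤ : Subgroup G)) = 1 := rfl
        rw [this, map_one, Module.End.one_eq_id, LinearEquiv.conj_id]; rfl
      map_mul' := fun g h => by
        have : (⟨g * h, Subgroup.mem_top _⟩ : (⊤ : Subgroup G)) =
          ⟨g, Subgroup.mem_top _⟩ * ⟨h, Subgroup.mem_top _⟩ := rfl
        rw [this, map_mul, Module.End.mul_eq_comp, LinearEquiv.conj_comp]; rfl }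
  have hf : ∀ t : S, (e.toLinearMap ∘ₗ p) t = e t := fun t => congrArg e (hp' t)
  have hequiv : ∀ g, ∀ s ∈ S,
      (e.toLinearMap ∘ₗ p) (ρ g s) = σ g ((e.toLinearMap ∘ₗ p) s) := by
    intro g s hs
    rw [hf ⟨s, hs⟩]
    have := hf ⟨ρ g s, hS.stable g (Subgroup.mem_top g) s hs⟩
    rw [this]
    change _ = e (hS.stable.subrep _ (e.symm (e _)))
    rw [e.symm_apply_apply]
    rfl
  have hinj : ∀ s ∈ S, (e.toLinearMap ∘ₗ p) s = 0 → s = 0 := by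
    intro s hs h0
    rw [hf ⟨s, hs⟩] at h0
    exact congrArg Subtype.val (e.map_eq_zero_iff.1 h0)
  refine ⟨σ, e.toLinearMap ∘ₗ p, ?_, hequiv, hinj⟩
  have htop : S.map (e.toLinearMap ∘ₗ p) = ⊤ := by
    rw [eq_top_iff]
    exact fun v _ => ⟨e.symm v, (e.symm v).2, by rw [hf, e.apply_symm_apply]⟩
  rw [← htop]
  exact hS.congr _ hinj
    (fun g hg => ⟨g, hg, 1, fun u hu => by rw [one_smul, hequiv g u hu]⟩)
    (fun g hg => ⟨g, hg, 1, fun u hu => by rw [one_smul, hequiv g u hu]⟩)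

lemma mem_cd_iff {d : ℕ} : d ∈ DegreeGraph.cd G ↔
    ∃ σ : Representation ℂ G (Fin d → ℂ), Simple σ ⊤ ⊤ := by
  constructor
  · rintro ⟨_, ⟨n, σ, hσ, rfl⟩, h1⟩
    have : n = d := by
      have h2 : σ.character 1 = (n : ℂ) := by
        rw [Representation.char_one, finrank_fin_fun]
      exact_mod_cast h2.symm.trans h1
    subst this
    exact ⟨σ, simple_top_iff_isIrreducible.2 hσ⟩
  · rintro ⟨σ, hσ⟩
    exact ⟨_, ⟨d, σ, simple_top_iff_isIrreducible.1 hσ, rfl⟩, by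
      rw [Representation.char_one, finrank_fin_fun]⟩

lemma cd_subset_of_surjective {f : G →* G'} (hf : Function.Surjective f) :
    DegreeGraph.cd G' ⊆ DegreeGraph.cd G := by
  intro d hd
  rw [mem_cd_iff] at hd ⊢
  obtain ⟨σ, hσ⟩ := hd
  refine ⟨σ.comp f, fun _ _ _ _ => Submodule.mem_top, hσ.ne_bot, fun T hT hst => ?_⟩
  refine hσ.eq_bot_or_eq T hT fun y _ w hw => ?_
  obtain ⟨x, rfl⟩ := hf y
  exact hst x (Subgroup.mem_top x) w hw

lemma exists_linearEquiv (f : W →ₗ[ℂ] W') (hf : ∀ s ∈ S, f s = 0 → s = 0)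
    {T : Submodule ℂ W'} (hT : S.map f = T) : ∃ e : S ≃ₗ[ℂ] T, ∀ s : S, (e s : W') = f s := by
  have hmem : ∀ s ∈ S, f s ∈ T := fun s hs => hT ▸ ⟨s, hs, rfl⟩
  refine ⟨LinearEquiv.ofBijective (f.restrict hmem) ⟨?_, ?_⟩, fun s => rfl⟩
  · rw [← LinearMap.ker_eq_bot, LinearMap.ker_eq_bot']
    rintro ⟨s, hs⟩ h
    exact Subtype.ext (hf s hs (congrArg Subtype.val h))
  · rintro ⟨t, ht⟩
    rw [← hT] at ht
    obtain ⟨s, hs, rfl⟩ := ht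
    exact ⟨⟨s, hs⟩, rfl⟩

lemma det_eq_of_equiv (e : W ≃ₗ[ℂ] W') {A : W →ₗ[ℂ] W} {B : W' →ₗ[ℂ] W'}
    (h : ∀ w, e (A w) = B (e w)) : LinearMap.det A = LinearMap.det B := by
  rw [← LinearMap.det_conj A e]
  congr 1
  ext w
  simp [h]

/-- Every irreducible representation of a normal subgroup lies under an irreducible
representation of the group. -/
lemma exists_simple_over [Finite G] {E : Subgroup G} {V : Type*} [AddCommGroup V] [Module ℂ V]
    [FiniteDimensional ℂ V] {σ : Representation ℂ E V} (hσ : Simple σ ⊤ ⊤) :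
    ∃ (d : ℕ) (τ : Representation ℂ G (Fin d → ℂ)) (T : Submodule ℂ (Fin d → ℂ))
      (e : T ≃ₗ[ℂ] V), Simple τ ⊤ ⊤ ∧ ∃ hT : Simple τ E T,
        ∀ (x : E) (t : T), e (hT.stable.subrep x t) = σ x (e t) := by
  classical
  let R : Representation ℂ G (G → V) :=
    { toFun := fun h => LinearMap.funLeft ℂ V (fun g => g * h)
      map_one' := by ext; simp [LinearMap.funLeft]
      map_mul' := fun g h => by
        refine LinearMap.ext fun f => funext fun g' => ?_
        -- The submodule `I` defined below is the induced representation, on which `G` acts by right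
        -- translation.
        simp [LinearMap.funLeft, mul_assoc] }
  have hR : ∀ h f g, R h f g = f (g * h) := fun _ _ _ => rfl
  let I : Submodule ℂ (G → V) :=
    { carrier := {f | ∀ (x : E) g, f (x * g) = σ x (f g)}
      add_mem' := fun {f f'} hf hf' x g => by simp [hf x g, hf' x g]
      zero_mem' := fun x g => by simp
      smul_mem' := fun c f hf x g => by simp [hf x g] }
  have hI : ∀ f ∈ I, ∀ (x : E) g, f (x * g) = σ x (f g) := fun f hf => hf
  have hIst : Stable R ⊤ I := by
    intro h _ f hf x g
    rw [hR, hR, mul_assoc, hI f hf]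
  obtain ⟨v₀, -, hv₀⟩ := Submodule.exists_mem_ne_zero_of_ne_bot hσ.ne_bot
  have hI0 : I ≠ ⊥ := by
    let f₀ : G → V := fun g => if h : g ∈ E then σ ⟨g, h⟩ v₀ else 0
    have hf₀ : f₀ ∈ I := by
      intro x g
      by_cases hg : g ∈ E
      · have hxg : (x : G) * g ∈ E := E.mul_mem x.2 hg
        have : (⟨(x : G) * g, hxg⟩ : E) = x * ⟨g, hg⟩ := rfl
        simp only [f₀, hg, hxg, dif_pos, this, map_mul, Module.End.mul_apply]
      · have hxg : (x : G) * g ∉ E := fun h => hg ((E.mul_mem_cancel_left x.2).1 h)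
        simp only [f₀, hg, hxg, dif_neg, not_false_eq_true, map_zero]
    intro h
    rw [h, Submodule.mem_bot] at hf₀
    apply hv₀
    have := congrFun hf₀ 1
    have h1 : (⟨1, E.one_mem⟩ : E) = 1 := rfl
    simpa [f₀, E.one_mem, h1] using this
  obtain ⟨S, hSI, hS⟩ := hIst.exists_simple_le hI0
  let ev : (G → V) →ₗ[ℂ] V := LinearMap.proj 1
  have hev : ∀ (x : E), ∀ f ∈ S, ev (R x f) = σ x (ev f) := by
    intro x f hf
    change f (1 * x) = σ x (f 1)
    rw [one_mul, ← hI f (hSI hf), mul_one]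
  have hSE : Stable R E S := fun x _ => hS.stable x (Subgroup.mem_top x)
  have hkst : Stable R E (S ⊓ LinearMap.ker ev) := by
    rintro x hx f ⟨hf, hf'⟩
    refine ⟨hSE x hx f hf, ?_⟩
    rw [SetLike.mem_coe, LinearMap.mem_ker] at hf' ⊢
    rw [hev ⟨x, hx⟩ f hf, hf', map_zero]
  -- Evaluation at `g` is evaluation at 1 after translation by `g`, so a stable space killed by `ev`
  -- is zero.
  have hk : ¬ S ≤ LinearMap.ker ev := by
    intro h
    refine hS.ne_bot ((Submodule.eq_bot_iff _).2 fun f hf => funext fun g => ?_)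
    have h2 : R g f (1 : G) = 0 := h (hS.stable g (Subgroup.mem_top g) f hf)
    rwa [hR, one_mul] at h2
  -- On a complement of the kernel of `ev` in `S`, evaluation is injective; a simple `E`-submodule
  -- there is a copy of `σ`.
  obtain ⟨C, hC, hcompl⟩ := hkst.exists_isCompl
  have hCS : C ⊓ S ≠ ⊥ := by
    intro h0
    apply hk
    have : (S ⊓ LinearMap.ker ev) ⊔ (C ⊓ S) = S := by
      rw [← sup_inf_assoc_of_le _ inf_le_left, hcompl.sup_eq_top, top_inf_eq]
    rw [h0, sup_bot_eq] at this
    exact this ▸ inf_le_right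
  obtain ⟨T, hTC, hT⟩ := (hC.inf hSE).exists_simple_le hCS
  have hTS : T ≤ S := hTC.trans inf_le_right
  have hTinj : ∀ t ∈ T, ev t = 0 → t = 0 := by
    intro t ht h0
    have : t ∈ (S ⊓ LinearMap.ker ev) ⊓ C := ⟨⟨hTS ht, h0⟩, (hTC ht).1⟩
    rwa [hcompl.inf_eq_bot, Submodule.mem_bot] at this
  have hTmap : T.map ev = ⊤ := by
    have h := hT.congr (ρ' := σ) (X' := ⊤) ev hTinj
      (fun x hx => ⟨⟨x, hx⟩, Subgroup.mem_top _, 1, fun u hu => by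
        rw [one_smul, ← hev ⟨x, hx⟩ u (hTS hu)]⟩)
      (fun x _ => ⟨x, x.2, 1, fun u hu => by rw [one_smul, ← hev x u (hTS hu)]⟩)
    exact (hσ.eq_bot_or_eq _ le_top h.stable).resolve_left h.ne_bot
  obtain ⟨τ, f, hτ, hequiv, hinj⟩ := hS.exists_model
  obtain ⟨e₁, he₁⟩ := exists_linearEquiv ev hTinj hTmap
  obtain ⟨e₂, he₂⟩ := exists_linearEquiv (S := T) f (fun t ht => hinj t (hTS ht)) rfl
  have hfT : Simple τ E (T.map f) := hT.congr f (fun t ht => hinj t (hTS ht))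
    (fun x hx => ⟨x, hx, 1, fun u hu => by rw [one_smul, hequiv x u (hTS hu)]⟩)
    (fun x hx => ⟨x, hx, 1, fun u hu => by rw [one_smul, hequiv x u (hTS hu)]⟩)
  refine ⟨_, τ, T.map f, (e₂.symm.trans e₁).trans (LinearEquiv.ofTop ⊤ rfl), hτ, hfT,
    fun x t => ?_⟩
  obtain ⟨t, rfl⟩ := e₂.surjective t
  have h3 : hfT.stable.subrep x (e₂ t) = e₂ (hT.stable.subrep x t) := by
    refine Subtype.ext ?_
    rw [Stable.coe_subrep_apply, he₂, he₂, ← hequiv x t (hTS t.2)]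
    rfl
  rw [h3]
  simp only [LinearEquiv.trans_apply, LinearEquiv.symm_apply_apply, LinearEquiv.ofTop_apply, he₁]
  exact hev x t (hTS t.2)

/-- Degrees over a given irreducible representation `σ` of a normal subgroup `E`: a prime `r` that
does not divide the degree forces the determinant of `σ` to be invariant under (conjugates of) the
elements whose order modulo `E` is a power of `r`. -/
theorem exists_degree_over [Finite G] {E : Subgroup G} [E.Normal]
    {V : Type*} [AddCommGroup V] [Module ℂ V] [FiniteDimensional ℂ V]
    {σ : Representation ℂ E V} (hσ : Simple σ ⊤ ⊤) :
    ∃ d ∈ DegreeGraph.cd G, finrank ℂ V ∣ d ∧ ∀ r k : ℕ, r.Prime → ¬ r ∣ d →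
      ∀ x : G, x ^ r ^ k ∈ E → ∃ g : G, ∀ y z : E,
        (z : G) = g * x * g⁻¹ * y * (g * x * g⁻¹)⁻¹ →
          LinearMap.det (σ z) = LinearMap.det (σ y) := by
  obtain ⟨d, τ, T, e, hτ, hT, he⟩ := exists_simple_over hσ
  refine ⟨d, mem_cd_iff.2 ⟨τ, hτ⟩, ?_, fun r k hr hrd x hx => ?_⟩
  · rw [← e.finrank_eq]
    simpa using hτ.finrank_dvd hT
  obtain ⟨U, hU, hUx⟩ := exists_simple_stable (ρ := τ) hr (by simpa using hrd) hx
  obtain ⟨g, f, hf, hinj, hmap⟩ := hτ.exists_conj hU hT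
  obtain ⟨e', he'⟩ := exists_linearEquiv f hinj hmap
  -- `T` affords `σ` and is the conjugate by `g` of the `x`-stable module `U`. So the determinant of
  -- `σ` can be read off on `U`, where conjugation by `x` does not change it.
  have hdet : ∀ (y : E) (u : E), (u : G) = g⁻¹ * y * g →
      LinearMap.det (σ y) = LinearMap.det (hU.stable.subrep u) := by
    intro y u hu
    rw [← det_eq_of_equiv e (he y)]
    refine (det_eq_of_equiv e' fun w => Subtype.ext ?_).symm
    rw [Stable.coe_subrep_apply, he', he', Stable.coe_subrep_apply, hu]
    exact hf y y.2 w w.2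
  refine ⟨g, fun y z hz => ?_⟩
  have hconj : ∀ a : E, g⁻¹ * (a : G) * g ∈ E := fun a => by
    simpa using ‹E.Normal›.conj_mem a a.2 g⁻¹
  rw [hdet z ⟨_, hconj z⟩ rfl, hdet y ⟨_, hconj y⟩ rfl]
  have hxinj : ∀ u ∈ U, τ x u = 0 → u = 0 := fun u _ h => by
    have := congrArg (τ x⁻¹) h
    simpa using this
  have hUmap : U.map (τ x) = U :=
    Submodule.eq_of_le_of_finrank_eq (Submodule.map_le_iff_le_comap.2 hUx)
      (finrank_map_eq _ hxinj)
  obtain ⟨e'', he''⟩ := exists_linearEquiv (τ x) hxinj hUmap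
  refine (det_eq_of_equiv e'' fun w => Subtype.ext ?_).symm
  rw [Stable.coe_subrep_apply, he'', he'', Stable.coe_subrep_apply]
  simp only [hz]
  rw [← Module.End.mul_apply, ← map_mul, ← Module.End.mul_apply, ← map_mul]
  congr 2
  group

end Clifford

/-! ### Twisting by linear characters, and the effect of missing edges. -/

namespace Clifford

variable {G : Type*} [Group G]

lemma exists_linear_apply_ne_one [Finite G] {M E : Subgroup G} [M.Normal] (hM : ⁅E, E⁆ ≤ M)
    {w : G} (hw : w ∈ E) (hwM : w ∉ M) :
    ∃ χ : E →* ℂˣ, (∀ y : E, (y : G) ∈ M → χ y = 1) ∧ χ ⟨w, hw⟩ ≠ 1 := by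
  let Q := E.map (QuotientGroup.mk' M)
  let _ : CommGroup Q :=
    { (inferInstance : Group Q) with
      mul_comm := by
        rintro ⟨_, a, ha, rfl⟩ ⟨_, b, hb, rfl⟩
        refine Subtype.ext ?_
        have h : ⁅a, b⁆ ∈ M := hM (Subgroup.commutator_mem_commutator ha hb)
        rw [← QuotientGroup.ker_mk' M, MonoidHom.mem_ker, map_commutatorElement,
          commutatorElement_eq_one_iff_mul_comm] at h
        exact h }
  let π : E →* Q := (QuotientGroup.mk' M).subgroupMap E
  have hker : ∀ y : E, π y = 1 ↔ (y : G) ∈ M := by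
    intro y
    rw [Subtype.ext_iff]
    exact QuotientGroup.eq_one_iff (y : G)
  obtain ⟨φ, hφ⟩ := CommGroup.exists_apply_ne_one_of_hasEnoughRootsOfUnity Q ℂ
    (a := π ⟨w, hw⟩) (fun h => hwM ((hker _).1 h))
  exact ⟨φ.comp π, fun y hy => by rw [MonoidHom.comp_apply, (hker y).2 hy, map_one], hφ⟩

/-- The product of a representation with a linear character. -/
def twist {V : Type*} [AddCommGroup V] [Module ℂ V] (χ : G →* ℂˣ) (σ : Representation ℂ G V) :
    Representation ℂ G V where
  toFun g := (χ g : ℂ) • σ g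
  map_one' := by simp
  map_mul' g h := by
    rw [map_mul, map_mul, smul_mul_smul_comm, Units.val_mul]

lemma twist_apply {V : Type*} [AddCommGroup V] [Module ℂ V] (χ : G →* ℂˣ)
    (σ : Representation ℂ G V) (g : G) : twist χ σ g = (χ g : ℂ) • σ g := rfl

lemma Simple.twist {V : Type*} [AddCommGroup V] [Module ℂ V] {σ : Representation ℂ G V}
    (hσ : Simple σ ⊤ ⊤) (χ : G →* ℂˣ) : Simple (twist χ σ) ⊤ ⊤ := by
  refine ⟨fun _ _ _ _ => Submodule.mem_top, hσ.ne_bot, fun T hT hst => ?_⟩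
  refine hσ.eq_bot_or_eq T hT fun g hg w hw => ?_
  have := T.smul_mem ((χ g)⁻¹ : ℂˣ).val (hst g hg w hw)
  rwa [twist_apply, LinearMap.smul_apply, smul_smul, Units.inv_mul, one_smul] at this

/-- In dimension one the determinant is the character itself, so `exists_degree_over` gives
invariance of `χ`. -/
lemma exists_degree_over_linear [Finite G] {E : Subgroup G} [E.Normal] (χ : E →* ℂˣ) :
    ∃ d ∈ DegreeGraph.cd G, ∀ r k : ℕ, r.Prime → ¬ r ∣ d →
      ∀ x : G, x ^ r ^ k ∈ E → ∃ g : G, ∀ y z : E,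
        (z : G) = g * x * g⁻¹ * y * (g * x * g⁻¹)⁻¹ → χ z = χ y := by
  have h1 : Simple (Representation.trivial ℂ E ℂ) ⊤ ⊤ := by
    refine ⟨fun _ _ _ _ => Submodule.mem_top, bot_ne_top.symm, fun T _ _ => ?_⟩
    exact eq_bot_or_eq_top (α := Submodule ℂ ℂ) T
  obtain ⟨d, hd, -, h⟩ := exists_degree_over (G := G) (h1.twist χ)
  have hdet : ∀ y : E, LinearMap.det (twist χ (Representation.trivial ℂ E ℂ) y) = χ y := by
    intro y
    have h2 : Representation.trivial ℂ E ℂ y = LinearMap.id := by ext; simp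
    rw [twist_apply, LinearMap.det_smul, finrank_self, pow_one, h2, LinearMap.det_id, mul_one]
  refine ⟨d, hd, fun r k hr hrd x hx => ?_⟩
  obtain ⟨g, hg⟩ := h r k hr hrd x hx
  refine ⟨g, fun y z hz => Units.ext ?_⟩
  rw [← hdet, ← hdet, hg y z hz]

/-- Let `M ≤ E` be normal with `G / E` and `E / M` abelian. If some degree is divisible by `u`
but not by `s`, and no degree is divisible by `r` and `u`, then the `r`-elements of `G / E` act
trivially on the `s`-elements of `E / M`. -/
theorem commutator_mem_of_not_dvd [Finite G] {M E : Subgroup G} [M.Normal] [E.Normal]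
    (hE : commutator G ≤ E) (hM : ⁅E, E⁆ ≤ M) {d u r s : ℕ} (hd : d ∈ DegreeGraph.cd G)
    (hu : u.Prime) (hr : r.Prime) (hs : s.Prime) (hud : u ∣ d) (huE : ¬ u ∣ E.index)
    (hsd : ¬ s ∣ d) (hur : ∀ d' ∈ DegreeGraph.cd G, u ∣ d' → ¬ r ∣ d') {x y : G} {k j : ℕ}
    (hx : x ^ r ^ k ∈ E) (hy : y ∈ E) (hys : y ^ s ^ j ∈ M) : ⁅x, y⁆ ∈ M := by
  obtain ⟨τ, hτ⟩ := mem_cd_iff.1 hd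
  obtain ⟨U, -, hU⟩ := Stable.exists_simple_le (ρ := τ) (X := E) (S := ⊤)
    (fun _ _ _ _ => Submodule.mem_top) hτ.ne_bot
  have hUd : finrank ℂ U ∣ d := by simpa using hτ.finrank_dvd hU
  have hdU : d ∣ E.index * finrank ℂ U := by
    simpa using hτ.finrank_dvd_relIndex_mul hE hU.stable le_top
  have hsU : ¬ s ∣ finrank ℂ U := fun h => hsd (h.trans hUd)
  have huU : u ∣ finrank ℂ U := (hu.dvd_mul.1 (hud.trans hdU)).resolve_left huE
  have hconj : ∀ y ∈ E, x * y * x⁻¹ ∈ E := fun y hy => ‹E.Normal›.conj_mem y hy x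
  -- The degree `d'` found over the twist of `U` by `χ` is a multiple of `dim U`, hence of `u`,
  -- hence not of `r`. The determinant is thus invariant under a conjugate of `x`. As `G / E` is
  -- abelian, this conjugate is `x` times an element of `E`, and conjugation within `E` preserves
  -- determinants.
  have hdet : ∀ (χ : E →* ℂˣ) (y : E),
      LinearMap.det (twist χ hU.stable.subrep ⟨x * y * x⁻¹, hconj y y.2⟩) =
        LinearMap.det (twist χ hU.stable.subrep y) := by
    intro χ y
    obtain ⟨d', hd', hUd', h⟩ := exists_degree_over (G := G) (hU.subrep.twist χ)
    obtain ⟨g, hg⟩ := h r k hr (hur d' hd' (huU.trans hUd')) x hx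
    let D : E →* ℂ := LinearMap.det.comp (twist χ hU.stable.subrep)
    have he : ⁅x⁻¹, g⁆ ∈ E := hE (Subgroup.commutator_mem_commutator trivial trivial)
    let e : E := ⟨⁅x⁻¹, g⁆, he⟩
    have h1 := hg (e⁻¹ * y * e) ⟨x * y * x⁻¹, hconj y y.2⟩ (by
      simp only [e, Subgroup.coe_mul, Subgroup.coe_inv, commutatorElement_def]
      group)
    rw [h1]
    change D (e⁻¹ * y * e) = D y
    rw [map_mul, map_mul, mul_right_comm, ← map_mul, inv_mul_cancel, map_one, one_mul]
  -- Dividing the invariance for `χ` by that for the trivial character leaves the power `χ ^ dim U`.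
  have hpow : ∀ (χ : E →* ℂˣ) (y : E),
      (χ ⟨x * y * x⁻¹, hconj y y.2⟩) ^ finrank ℂ U = χ y ^ finrank ℂ U := by
    intro χ y
    have h0 := hdet 1 y
    have h1 := hdet χ y
    simp only [twist_apply, LinearMap.det_smul, MonoidHom.one_apply, Units.val_one, one_pow,
      one_mul] at h0 h1
    rw [h0] at h1
    have hne : LinearMap.det (hU.stable.subrep y) ≠ 0 := by
      have := (Group.isUnit y).map (LinearMap.det.comp hU.stable.subrep)
      exact this.ne_zero
    exact Units.ext (by simpa using mul_right_cancel₀ hne h1)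
  by_contra hw
  have hwE : ⁅x, y⁆ ∈ E := by
    rw [commutatorElement_def]
    exact E.mul_mem (hconj y hy) (E.inv_mem hy)
  obtain ⟨χ, hχM, hχ⟩ := exists_linear_apply_ne_one hM hwE hw
  apply hχ
  have hsplit : (⟨⁅x, y⁆, hwE⟩ : E) = ⟨x * y * x⁻¹, hconj y hy⟩ * (⟨y, hy⟩ : E)⁻¹ := rfl
  have h1 : χ ⟨⁅x, y⁆, hwE⟩ ^ finrank ℂ U = 1 := by
    rw [hsplit, map_mul, map_inv, mul_pow, inv_pow, hpow χ ⟨y, hy⟩, mul_inv_cancel]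
  have h2 : χ ⟨⁅x, y⁆, hwE⟩ ^ s ^ j = 1 := by
    rw [hsplit, map_mul, map_inv, mul_pow, inv_pow, ← map_pow, ← map_pow,
      hχM ((⟨y, hy⟩ : E) ^ s ^ j) hys, hχM, inv_one, one_mul]
    change (x * y * x⁻¹) ^ s ^ j ∈ M
    rw [conj_pow]
    exact ‹M.Normal›.conj_mem _ hys x
  -- The value of `χ` at the commutator is killed by `dim U` and by a power of `s`, which are
  -- coprime.
  have hcop : (finrank ℂ U).Coprime (s ^ j) :=
    (((Nat.Prime.coprime_iff_not_dvd hs).2 hsU).symm.pow_right j)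
  exact (pow_eq_one_iff_of_coprime hcop).1 ⟨h1, h2⟩

/-- Simple modules for the abelian group `M` are one-dimensional. Going up the two abelian layers `E
/ M` and `G / E` shows that `d` divides `|G : E| |E : M|`. -/
lemma prime_dvd_of_mem_cd [Finite G] {M E : Subgroup G} [M.Normal] [E.Normal]
    (hE : commutator G ≤ E) (hM : ⁅E, E⁆ ≤ M) (hME : M ≤ E)
    (hcomm : ∀ a ∈ M, ∀ b ∈ M, a * b = b * a)
    {d r : ℕ} (hd : d ∈ DegreeGraph.cd G) (hr : r.Prime) (hrd : r ∣ d) :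
    r ∣ E.index ∨ r ∣ M.relIndex E := by
  obtain ⟨τ, hτ⟩ := mem_cd_iff.1 hd
  obtain ⟨U, -, hU⟩ := Stable.exists_simple_le (ρ := τ) (X := E) (S := ⊤)
    (fun _ _ _ _ => Submodule.mem_top) hτ.ne_bot
  have hdU : d ∣ E.index * finrank ℂ U := by
    simpa using hτ.finrank_dvd_relIndex_mul hE hU.stable le_top
  obtain ⟨U', hU'U, hU'⟩ := Stable.exists_simple_le (ρ := τ) (X := M) (S := U)
    (fun x hx => hU.stable x (hME hx)) hU.ne_bot
  have hUU' := hU.finrank_dvd_relIndex_mul hM hU'.stable hU'U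
  have hone : finrank ℂ U' = 1 := by
    have : IsMulCommutative M := ⟨⟨fun a b => Subtype.ext (hcomm a a.2 b b.2)⟩⟩
    have := simple_top_iff_isIrreducible.1 hU'.subrep
    exact Representation.IsIrreducible.finrank_eq_one_of_isMulCommutative hU'.stable.subrep
  rw [hone, mul_one] at hUU'
  exact hr.dvd_mul.1 (hrd.trans (hdU.trans (Nat.mul_dvd_mul_left _ hUU')))

end Clifford

/-! ### The field generated by an irreducible commutative group of operators. -/

/-- A commutative group of operators acting irreducibly on a finite abelian group `A` generates a
field of the size of `A`, on which the normaliser acts by automorphisms. -/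
theorem exists_field_of_irreducible {A H : Type*} [AddCommGroup A] [Finite A] [Nontrivial A]
    [Group H] (act : H →* AddMonoid.End A) (K : Subgroup H) [K.Normal]
    (hcomm : ∀ k ∈ K, ∀ l ∈ K, act k * act l = act l * act k)
    (hirr : ∀ B : AddSubgroup A, (∀ k ∈ K, ∀ b ∈ B, act k b ∈ B) → B = ⊥ ∨ B = ⊤) :
    ∃ (F : Subring (AddMonoid.End A)) (_ : Field F) (_ : Finite F) (j : K →* Fˣ)
      (Γ : H →* (F ≃+* F)),
      Nat.card F = Nat.card A ∧ (∀ k, j k = 1 ↔ act k = 1) ∧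
      (∀ (h : H) (k l : K), (l : H) = h * k * h⁻¹ → Γ h (j k) = j l) ∧
      (∀ h, (∀ k, Γ h (j k) = j k) → Γ h = 1) ∧
      ∀ h h', Γ h = 1 → Γ h' = 1 → act h * act h' = act h' * act h := by
  let S : Subring (AddMonoid.End A) := Subring.closure (act '' K)
  have hsub : ∀ k ∈ K, act k ∈ S := fun k hk => Subring.subset_closure ⟨k, hk, rfl⟩
  have hSc : IsMulCommutative S := Subring.isMulCommutative_closure (by
    rintro _ ⟨k, hk, rfl⟩ _ ⟨l, hl, rfl⟩
    exact hcomm k hk l hl)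
  let _ : CommRing S := { (inferInstance : Ring S) with mul_comm := hSc.is_comm.comm }
  have hS : ∀ s ∈ S, ∀ t ∈ S, s * t = t * s := fun s hs t ht =>
    congrArg Subtype.val (mul_comm (⟨s, hs⟩ : S) ⟨t, ht⟩)
  have hinj : ∀ s ∈ S, ∀ a, a ≠ 0 → s a = 0 → s = 0 := by
    intro s hs a ha hsa
    have hker : ∀ k ∈ K, ∀ b ∈ s.ker, act k b ∈ s.ker := by
      intro k hk b hb
      have : (s * act k) b = (act k * s) b := by rw [hS s hs _ (hsub k hk)]
      exact this.trans ((congrArg (act k) hb).trans (map_zero _))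
    rcases hirr s.ker hker with h | h
    · exact absurd ((AddSubgroup.mem_bot).1 (h ▸ (AddMonoidHom.mem_ker.2 hsa))) ha
    · refine AddMonoidHom.ext fun b => ?_
      exact AddMonoidHom.mem_ker.1 (h ▸ AddSubgroup.mem_top b)
  have : Finite (AddMonoid.End A) := DFunLike.finite _
  have : IsDomain S := by
    have : NoZeroDivisors S := by
      refine ⟨fun {s t} hst => ?_⟩
      by_contra! hne
      apply hne.2
      refine Subtype.ext (AddMonoidHom.ext fun a => ?_)
      by_contra hta
      have h0 : s.1 (t.1 a) = 0 := DFunLike.congr_fun (congrArg Subtype.val hst) a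
      exact hne.1 (Subtype.ext (hinj s.1 s.2 _ hta h0))
    have : Nontrivial S := by
      obtain ⟨a, ha⟩ := exists_ne (0 : A)
      refine ⟨0, 1, fun h => ha ?_⟩
      exact (DFunLike.congr_fun (congrArg Subtype.val h) a).symm
    exact NoZeroDivisors.to_isDomain S
  obtain ⟨v, hv⟩ := exists_ne (0 : A)
  -- The `S`-orbit of `v` is a nonzero `K`-stable subgroup, hence everything: `A` is one-dimensional
  -- over the field `S`.
  have hsurj : ∀ a, ∃ s ∈ S, s v = a := by
    let ev : AddMonoid.End A →+ A :=
      { toFun := fun s => s v, map_zero' := rfl, map_add' := fun _ _ => rfl }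
    have hst : ∀ k ∈ K, ∀ b ∈ S.toAddSubgroup.map ev, act k b ∈ S.toAddSubgroup.map ev := by
      rintro k hk _ ⟨s, hs, rfl⟩
      exact ⟨act k * s, S.mul_mem (hsub k hk) hs, rfl⟩
    rcases hirr _ hst with h | h
    · have : v ∈ S.toAddSubgroup.map ev := ⟨1, S.one_mem, rfl⟩
      rw [h, AddSubgroup.mem_bot] at this
      exact absurd this hv
    · intro a
      have : a ∈ S.toAddSubgroup.map ev := h ▸ AddSubgroup.mem_top a
      exact this
  have hcard : Nat.card S = Nat.card A := by
    refine Nat.card_congr (Equiv.ofBijective (fun s : S => s.1 v) ⟨fun s t hst => ?_, fun a => ?_⟩)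
    · have : (s.1 - t.1) v = 0 := by
        exact sub_eq_zero.2 hst
      exact Subtype.ext (sub_eq_zero.1 (hinj _ (S.sub_mem s.2 t.2) v hv this))
    · obtain ⟨s, hs, h⟩ := hsurj a
      exact ⟨⟨s, hs⟩, h⟩
  have hconj : ∀ h : H, ∀ s ∈ S, act h * s * act h⁻¹ ∈ S := by
    intro h s hs
    induction hs using Subring.closure_induction with
    | mem s hs =>
      obtain ⟨k, hk, rfl⟩ := hs
      rw [← map_mul, ← map_mul]
      exact hsub _ (‹K.Normal›.conj_mem k hk h)
    | zero => simp
    | one => simp [← map_mul]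
    | add s t _ _ hs ht => rw [mul_add, add_mul]; exact S.add_mem hs ht
    | neg s _ hs => rw [mul_neg, neg_mul]; exact S.neg_mem hs
    | mul s t _ _ hs ht =>
      have : act h * (s * t) * act h⁻¹ = (act h * s * act h⁻¹) * (act h * t * act h⁻¹) := by
        simp only [mul_assoc]
        rw [← mul_assoc (act h⁻¹), ← map_mul, inv_mul_cancel, map_one, one_mul]
      rw [this]
      exact S.mul_mem hs ht
  have hmm : ∀ h : H, act h⁻¹ * act h = 1 := fun h => by rw [← map_mul]; simp
  have hmm' : ∀ h : H, act h * act h⁻¹ = 1 := fun h => by rw [← map_mul]; simp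
  let γ (h : H) : S ≃+* S :=
    { toFun := fun s => ⟨act h * s * act h⁻¹, hconj h s s.2⟩
      invFun := fun s => ⟨act h⁻¹ * s * act h, by simpa using hconj h⁻¹ s s.2⟩
      left_inv := fun s => Subtype.ext (by
        change act h⁻¹ * (act h * s.1 * act h⁻¹) * act h = s.1
        rw [mul_assoc, mul_assoc, hmm, mul_one, ← mul_assoc, hmm, one_mul])
      right_inv := fun s => Subtype.ext (by
        change act h * (act h⁻¹ * s.1 * act h) * act h⁻¹ = s.1
        rw [mul_assoc, mul_assoc, hmm', mul_one, ← mul_assoc, hmm', one_mul])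
      map_mul' := fun s t => Subtype.ext (by
        change act h * (s.1 * t.1) * act h⁻¹ = (act h * s.1 * act h⁻¹) * (act h * t.1 * act h⁻¹)
        simp only [mul_assoc]
        rw [← mul_assoc (act h⁻¹), hmm, one_mul])
      map_add' := fun s t => Subtype.ext (by
        change act h * (s.1 + t.1) * act h⁻¹ = act h * s.1 * act h⁻¹ + act h * t.1 * act h⁻¹
        rw [mul_add, add_mul]) }
  have hγ : ∀ h s, ((γ h s : S) : AddMonoid.End A) = act h * s * act h⁻¹ := fun _ _ => rfl
  let Γ : H →* (S ≃+* S) :=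
    { toFun := γ
      map_one' := RingEquiv.ext fun s => Subtype.ext (by rw [hγ]; simp)
      map_mul' := fun h h' => RingEquiv.ext fun s => Subtype.ext (by
        rw [RingAut.mul_apply, hγ, hγ, hγ, mul_inv_rev, map_mul, map_mul]
        simp only [mul_assoc]) }
  let j : K →* Sˣ := MonoidHom.toHomUnits
    { toFun := fun k => ⟨act k, hsub k k.2⟩
      map_one' := Subtype.ext (by simp)
      map_mul' := fun k l => Subtype.ext (by simp) }
  have hj : ∀ k : K, (((j k : Sˣ) : S) : AddMonoid.End A) = act k := fun _ => rfl
  have hΓ : ∀ h, Γ h = 1 → ∀ s ∈ S, act h * s = s * act h := by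
    intro h hh s hs
    have := congrArg Subtype.val (RingEquiv.congr_fun hh ⟨s, hs⟩)
    change act h * s * act h⁻¹ = s at this
    calc act h * s = act h * s * (act h⁻¹ * act h) := by rw [hmm, mul_one]
      _ = s * act h := by rw [← mul_assoc, this]
  -- An operator commuting with `S` is linear on a one-dimensional space, so it is multiplication by
  -- a scalar from `S`.
  have hmem : ∀ h, Γ h = 1 → act h ∈ S := by
    intro h hh
    obtain ⟨s, hs, hsv⟩ := hsurj (act h v)
    have : act h = s := by
      refine AddMonoidHom.ext fun a => ?_
      obtain ⟨t, ht, rfl⟩ := hsurj a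
      have h1 : (act h * t) v = (t * act h) v := by rw [hΓ h hh t ht]
      have h2 : (s * t) v = (t * s) v := by rw [hS s hs t ht]
      exact h1.trans ((congrArg t hsv.symm).trans h2.symm)
    rwa [this]
  refine ⟨S, (Finite.isField_of_domain S).toField, inferInstance, j, Γ, hcard, fun k => ?_,
    fun h k l hl => Subtype.ext ?_, fun h hh => RingEquiv.ext fun s => Subtype.ext ?_,
    fun h h' hh hh' => hS _ (hmem h hh) _ (hmem h' hh')⟩
  · rw [Units.ext_iff, Subtype.ext_iff]
    exact Iff.rfl
  · change act h * act k * act h⁻¹ = act l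
    rw [hl, map_mul, map_mul]
  · change act h * s.1 * act h⁻¹ = s.1
    have hcen : ∀ s ∈ S, act h * s = s * act h := by
      intro s hs
      induction hs using Subring.closure_induction with
      | mem s hs =>
        obtain ⟨k, hk, rfl⟩ := hs
        have := congrArg Subtype.val (hh ⟨k, hk⟩)
        change act h * act k * act h⁻¹ = act k at this
        calc act h * act k = act h * act k * (act h⁻¹ * act h) := by rw [hmm, mul_one]
          _ = act k * act h := by rw [← mul_assoc, this]
      | zero => simp
      | one => simp
      | add s t _ _ hs ht => rw [mul_add, add_mul, hs, ht]
      | neg s _ hs => rw [mul_neg, neg_mul, hs]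
      | mul s t _ _ hs ht => rw [← mul_assoc, hs, mul_assoc, ht, mul_assoc]
    rw [hcen s.1 s.2, mul_assoc, hmm', mul_one]

/-! ### Units of a finite field fixed by automorphisms: the counting argument. -/

/-- A subgroup containing `h ^ n ∈ X` and all powers of `h` of prime power order modulo `X`
contains `h`. -/
lemma mem_of_primary_powers_mem {G : Type*} [Group G] {X T : Subgroup G} (hXT : X ≤ T) {h : G}
    {n : ℕ} (hn : n ≠ 0) (hX : h ^ n ∈ X)
    (hT : ∀ r k i : ℕ, r.Prime → r ∣ n → (h ^ i) ^ r ^ k ∈ X → h ^ i ∈ T) : h ∈ T := by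
  have hex : ∃ i, i ≠ 0 ∧ h ^ i ∈ T := ⟨n, hn, hXT hX⟩
  classical
  obtain ⟨ho, hoT⟩ := Nat.find_spec hex
  set o := Nat.find hex
  have hmin : ∀ i, h ^ i ∈ T → o ∣ i := by
    intro i hi
    by_contra hdvd
    have hlt : i % o < o := Nat.mod_lt _ (Nat.pos_of_ne_zero ho)
    refine Nat.find_min hex hlt ⟨fun h0 => hdvd (Nat.dvd_of_mod_eq_zero h0), ?_⟩
    have h1 : h ^ i = h ^ (i % o) * (h ^ o) ^ (i / o) := by
      rw [← pow_mul, ← pow_add, Nat.mod_add_div]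
    rw [h1] at hi
    exact (T.mul_mem_cancel_right (T.pow_mem hoT _)).1 hi
  by_cases h1 : o = 1
  · rw [h1, pow_one] at hoT
    exact hoT
  -- With `n = r ^ k * j` and `r ∤ j`, the power `h ^ j` is an `r`-element modulo `X`, so it lies in
  -- `T`; then `r ∣ o ∣ j`, which is absurd.
  · obtain ⟨r, hr, hro⟩ := Nat.exists_prime_and_dvd h1
    have hrn : r ∣ n := hro.trans (hmin n (hXT hX))
    obtain ⟨k, j, hj, rfl⟩ := Nat.exists_eq_pow_mul_and_not_dvd hn r hr.ne_one
    refine absurd (hro.trans (hmin j (hT r k j hr hrn ?_))) hj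
    rwa [← pow_mul, mul_comm]

/-- Every automorphism fixes the prime field, so this is a Galois group of finite fields. -/
lemma isCyclic_ringAut (F : Type*) [Field F] [Finite F] : IsCyclic (F ≃+* F) := by
  obtain ⟨p, hp⟩ := CharP.exists F
  have : Fact p.Prime := ⟨CharP.char_is_prime F p⟩
  let _ : Algebra (ZMod p) F := ZMod.algebra F p
  let f : (F ≃+* F) →* Gal(F/ZMod p) :=
    { toFun := fun σ => AlgEquiv.ofRingEquiv (f := σ) (fun x => by
        exact RingHom.congr_fun
          (Subsingleton.elim ((σ : F →+* F).comp (algebraMap (ZMod p) F)) (algebraMap _ _)) x)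
      map_one' := AlgEquiv.ext fun _ => rfl
      map_mul' := fun _ _ => AlgEquiv.ext fun _ => rfl }
  exact isCyclic_of_injective f fun σ τ h => RingEquiv.ext fun x => AlgEquiv.congr_fun h x

/-- The units of a finite field fixed by an automorphism. -/
def fixedUnits {F : Type*} [Field F] (σ : F ≃+* F) : Subgroup Fˣ where
  carrier := {u | σ u = u}
  one_mem' := by simp
  mul_mem' {u v} hu hv := by
    simp only [Set.mem_ofPred_eq, Units.val_mul, map_mul] at *
    rw [hu, hv]
  inv_mem' {u} hu := by
    simp only [Set.mem_ofPred_eq, Units.val_inv_eq_inv_val, map_inv₀] at *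
    rw [hu]

/-- By Artin's theorem `F` has degree `orderOf σ` over the fixed field, which therefore has order
`c`. The inequality is strict because zero is not a unit. -/
lemma card_fixedUnits_lt {F : Type*} [Field F] [Finite F] {σ : F ≃+* F} {c : ℕ}
    (hc : c ^ orderOf σ = Nat.card F) : Nat.card (fixedUnits σ) < c := by
  let D := Subgroup.zpowers σ
  have : Finite (F ≃+* F) := DFunLike.finite _
  have := Fintype.ofFinite D
  let F₀ := FixedPoints.subfield D F
  have hcard : Nat.card F₀ ^ orderOf σ = Nat.card F := by
    rw [← Nat.card_zpowers, Nat.card_eq_fintype_card (α := Subgroup.zpowers σ),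
      ← FixedPoints.finrank_eq_card D F]
    exact (Module.natCard_eq_pow_finrank (K := F₀) (V := F)).symm
  have hc0 : Nat.card F₀ = c :=
    Nat.pow_left_injective (orderOf_pos σ).ne' (hcard.trans hc.symm)
  have hfix : ∀ u : Fˣ, u ∈ fixedUnits σ → (u : F) ∈ F₀ := by
    rintro u hu ⟨τ, hτ⟩
    have hle : D ≤ MulAction.stabilizer (F ≃+* F) (u : F) := by
      rw [Subgroup.zpowers_le]
      exact hu
    exact hle hτ
  have hlt : Nat.card (fixedUnits σ) ≤ Nat.card F₀ˣ := by
    refine Nat.card_le_card_of_injective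
      (fun u => Units.mk0 (⟨(u : Fˣ), hfix u u.2⟩ : F₀) fun h => ?_) fun u v h => ?_
    · exact (u : Fˣ).ne_zero (congrArg Subtype.val h)
    · exact Subtype.ext (Units.ext (congrArg Subtype.val (congrArg Units.val h)))
  rw [← hc0]
  refine lt_of_le_of_lt hlt ?_
  rw [Nat.card_units]
  exact Nat.sub_lt Nat.card_pos Nat.one_pos

lemma Subgroup.card_sup_le_mul {A : Type*} [CommGroup A] [Finite A] (B C : Subgroup A) :
    Nat.card (B ⊔ C : Subgroup A) ≤ Nat.card B * Nat.card C := by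
  rw [← Nat.card_prod]
  refine Nat.card_le_card_of_surjective (fun b : B × C => (⟨b.1 * b.2,
    (B ⊔ C).mul_mem (Subgroup.mem_sup_left b.1.2) (Subgroup.mem_sup_right b.2.2)⟩ :
      (B ⊔ C : Subgroup A))) ?_
  rintro ⟨a, ha⟩
  obtain ⟨b, hb, c, hc, rfl⟩ := Subgroup.mem_sup.1 ha
  exact ⟨⟨⟨b, hb⟩, ⟨c, hc⟩⟩, rfl⟩

/-- The top term `q ^ (x * y - 1)` of the geometric sum already suffices, since `x + y + 1 ≤ x * y`.
This last bound fails for `x = y = 2`. -/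
lemma pow_add_lt_geom {q x y : ℕ} (hq : 2 ≤ q) (hx : 1 < x) (hy : 1 < y) (hxy : x ≠ y) :
    q ^ y * q ^ x ≤ (q ^ (x * y) - 1) / (q - 1) := by
  have hle : x + y ≤ x * y - 1 := by
    have h : x + y + 1 ≤ x * y := by
      rcases Nat.lt_or_gt_of_ne hxy with h | h
      · nlinarith
      · nlinarith
    omega
  have hgeom : q ^ (x * y - 1) ≤ (q ^ (x * y) - 1) / (q - 1) := by
    rw [← Nat.geomSum_eq hq]
    refine Finset.single_le_sum (f := fun i => q ^ i) (fun _ _ => Nat.zero_le _)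
      (Finset.mem_range.2 ?_)
    have : 0 < x * y := by positivity
    omega
  calc q ^ y * q ^ x = q ^ (x + y) := by rw [← pow_add, add_comm]
    _ ≤ q ^ (x * y - 1) := Nat.pow_le_pow_right (by omega) hle
    _ ≤ _ := hgeom

/-- Let `H` act by automorphisms on the finite field `F` of order `q ^ m` and `K → Fˣ` be an
equivariant map with large image. Then the elements of orders `x` and `y` modulo `K`,
where `m = x * y` with `x`, `y` coprime, cannot fix between them all primary parts of `K`. -/
theorem false_of_fixed_primary_parts {F H : Type*} [Field F] [Finite F] [Group H]
    {K : Subgroup H} (j : K →* Fˣ) (Γ : H →* (F ≃+* F)) (hΓ : Γ.ker = K) {q x y : ℕ}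
    (hq : 2 ≤ q) (hF : Nat.card F = q ^ (x * y)) (hK : K.index = x * y) (hcop : x.Coprime y)
    (hx : 1 < x) (hy : 1 < y) (hj : (q ^ (x * y) - 1) / (q - 1) ∣ Nat.card j.range)
    (hfix : ∀ s, s.Prime → s ∣ Nat.card j.range →
      (∀ h : H, h ^ x ∈ K → ∀ k i, j k ^ s ^ i = 1 → Γ h (j k) = j k) ∨
      (∀ h : H, h ^ y ∈ K → ∀ k i, j k ^ s ^ i = 1 → Γ h (j k) = j k)) : False := by
  have := isCyclic_ringAut F
  have : Finite (F ≃+* F) := DFunLike.finite _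
  -- The image of `Γ` is cyclic of order `x * y`; the power of a generator with exponent `b` has
  -- order `a`.
  have hord : ∀ a b : ℕ, a * b = x * y → b ≠ 0 → ∃ h : H, h ^ a ∈ K ∧ orderOf (Γ h) = a := by
    intro a b hab hb
    obtain ⟨⟨_, h, rfl⟩, hg⟩ := IsCyclic.exists_ofOrder_eq_natCard (α := Γ.range)
    rw [← Subgroup.orderOf_coe, ← Subgroup.index_ker, hΓ, hK, ← hab] at hg
    have h1 : orderOf (Γ (h ^ b)) = a := by
      rw [map_pow, orderOf_pow_of_dvd hb (by rw [hg]; exact Dvd.intro_left a rfl), hg,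
        Nat.mul_div_cancel _ (Nat.pos_of_ne_zero hb)]
    refine ⟨h ^ b, ?_, h1⟩
    rw [← hΓ, MonoidHom.mem_ker, map_pow, ← h1, pow_orderOf_eq_one]
  obtain ⟨h₁, hK₁, ho₁⟩ := hord x y rfl (by omega)
  obtain ⟨h₂, hK₂, ho₂⟩ := hord y x (mul_comm _ _) (by omega)
  have hc₁ : Nat.card (fixedUnits (Γ h₁)) < q ^ y :=
    card_fixedUnits_lt (by rw [ho₁, hF, ← pow_mul, mul_comm])
  have hc₂ : Nat.card (fixedUnits (Γ h₂)) < q ^ x :=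
    card_fixedUnits_lt (by rw [ho₂, hF, ← pow_mul])
  have hle : j.range ≤ fixedUnits (Γ h₁) ⊔ fixedUnits (Γ h₂) := by
    rintro _ ⟨k, rfl⟩
    refine mem_of_primary_powers_mem (X := ⊥) bot_le (n := Nat.card j.range) Nat.card_pos.ne'
      ?_ fun s i l hs hsn hmem => ?_
    · rw [Subgroup.mem_bot]
      exact congrArg Subtype.val (pow_card_eq_one' (x := (⟨j k, k, rfl⟩ : j.range)))
    · rw [Subgroup.mem_bot, ← map_pow] at hmem
      rw [← map_pow]
      rcases hfix s hs hsn with h | h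
      · exact Subgroup.mem_sup_left (h h₁ hK₁ _ i hmem)
      · exact Subgroup.mem_sup_right (h h₂ hK₂ _ i hmem)
  have hxy : x ≠ y := by
    rintro rfl
    rw [Nat.coprime_self] at hcop
    omega
  have h1 := Nat.le_of_dvd Nat.card_pos hj
  have h2 := Subgroup.card_le_of_le hle
  have h3 := Subgroup.card_sup_le_mul (fixedUnits (Γ h₁)) (fixedUnits (Γ h₂))
  have h4 := pow_add_lt_geom hq hx hy hxy
  have h5 : Nat.card (fixedUnits (Γ h₁)) * Nat.card (fixedUnits (Γ h₂)) < q ^ y * q ^ x :=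
    Nat.mul_lt_mul'' hc₁ hc₂
  omega

lemma Subgroup.normal_of_le_center {H : Type*} [Group H] {Z : Subgroup H}
    (h : Z ≤ Subgroup.center H) : Z.Normal := by
  refine ⟨fun z hz g => ?_⟩
  rwa [Subgroup.mem_center_iff.1 (h hz) g, mul_inv_cancel_right]

/-- A Sylow `s`-subgroup of `Y` contained in `X` would make the index prime to `s`. -/
lemma exists_prime_pow_eq_one_of_dvd_relIndex {H : Type*} [Group H] [Finite H] {X Y : Subgroup H}
    {s : ℕ} (hs : s.Prime) (h : s ∣ X.relIndex Y) :
    ∃ x ∈ Y, x ∉ X ∧ ∃ k, x ^ s ^ k = 1 := by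
  have : Fact s.Prime := ⟨hs⟩
  obtain ⟨P⟩ : Nonempty (Sylow s Y) := inferInstance
  have hP : ¬ (P : Subgroup Y) ≤ X.subgroupOf Y := fun hle =>
    P.not_dvd_index (h.trans (Subgroup.index_dvd_of_le hle))
  obtain ⟨x, hxP, hx⟩ := SetLike.not_le_iff_exists.1 hP
  obtain ⟨k, hk⟩ := P.isPGroup' ⟨x, hxP⟩
  exact ⟨x, x.2, hx, k, congrArg (fun y : P => ((y : Y) : H)) hk⟩

lemma exists_injective_unitsHom (F : Type*) [Field F] [Finite F] :
    ∃ ι : Fˣ →* ℂˣ, Function.Injective ι := by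
  have : NeZero (Nat.card Fˣ) := ⟨Nat.card_pos.ne'⟩
  have e : Fˣ ≃* rootsOfUnity (Nat.card Fˣ) ℂ :=
    mulEquivOfCyclicCardEq (Complex.card_rootsOfUnity _).symm
  exact ⟨(Subgroup.subtype _).comp e.toMonoidHom, (Subgroup.subtype_injective _).comp e.injective⟩

/-! ### Structure and degrees of the semidirect product `V ⋊ H`. -/

namespace DegreeGraph

instance fitting_normal (H : Type*) [Group H] : (fitting H).Normal :=
  Subgroup.sSup_normal _ fun _ hM => hM.1

namespace IsSemilinearProduct

variable {G : Type*} [Group G] {p m q : ℕ} {V H : Subgroup G} {Z K : Subgroup H}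

lemma mem_Z_iff (h : IsSemilinearProduct p m q V H Z K) {x : H} :
    x ∈ Z ↔ ∀ v ∈ V, (x : G) * v * (x : G)⁻¹ = v := by
  rw [h.Z_eq, Subgroup.mem_subgroupOf, Subgroup.mem_centralizer_iff]
  refine forall₂_congr fun v _ => ?_
  rw [mul_inv_eq_iff_eq_mul, eq_comm]

lemma K_normal (h : IsSemilinearProduct p m q V H Z K) : K.Normal :=
  h.K_eq ▸ fitting_normal H

lemma Z_le_K (h : IsSemilinearProduct p m q V H Z K) : Z ≤ K := by
  rw [h.K_eq]
  refine le_sSup ⟨Subgroup.normal_of_le_center h.Z_le_center, ?_⟩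
  let _ : CommGroup Z :=
    { (inferInstance : Group Z) with
      mul_comm := fun a b =>
        Subtype.ext (Subgroup.mem_center_iff.1 (h.Z_le_center b.2) (a : H)) }
  exact CommGroup.isNilpotent

/-- As `Z` is central, `L` has nilpotency class at most two and lies in the Fitting subgroup. -/
lemma le_K (h : IsSemilinearProduct p m q V H Z K) {L : Subgroup H} [L.Normal]
    (hL : ⁅L, L⁆ ≤ Z) : L ≤ K := by
  rw [h.K_eq]
  have : Group.IsNilpotent (Abelianization L) := CommGroup.isNilpotent
  refine le_sSup ⟨inferInstance, Subgroup.isNilpotent_of_ker_le_center (Abelianization.of (G := L)) ?_⟩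
  rw [Abelianization.ker_of]
  intro x hx
  rw [Subgroup.mem_center_iff]
  intro y
  have : (x : H) ∈ ⁅L, L⁆ := by
    have h1 := Subgroup.mem_map_of_mem L.subtype hx
    rwa [commutator_def, Subgroup.map_commutator, ← MonoidHom.range_eq_map,
      Subgroup.range_subtype] at h1
  exact Subtype.ext (Subgroup.mem_center_iff.1 (h.Z_le_center (hL this)) y)

open scoped IsMulCommutative in
/-- The field generated by `K` in the endomorphism ring of `V`, with the action of `H`. -/
theorem exists_field {G : Type u} [Group G] [Finite G] {V H : Subgroup G} {Z K : Subgroup H}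
    (h : IsSemilinearProduct p m q V H Z K) :
    ∃ (F : Type u) (_ : Field F) (_ : Finite F) (j : K →* Fˣ) (Γ : H →* (F ≃+* F)),
      Nat.card F = q ^ m ∧ (∀ k : K, j k = 1 ↔ (k : H) ∈ Z) ∧
      (∀ (x : H) (k l : K), (l : H) = x * k * x⁻¹ → Γ x (j k) = j l) ∧ Γ.ker = K ∧
      ∀ x, (∀ k, Γ x (j k) = j k) → x ∈ K := by
  have hV := h.normal
  have hK := h.K_normal
  have : IsMulCommutative V := ⟨⟨fun a b => Subtype.ext (h.comm a a.2 b b.2)⟩⟩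
  have : Nontrivial V := (Subgroup.nontrivial_iff_ne_bot V).2 h.ne_bot
  let act : H →* AddMonoid.End (Additive V) :=
    { toFun := fun x => MonoidHom.toAdditive (MulAut.conjNormal (x : G)).toMonoidHom
      map_one' := by ext; simp; rfl
      map_mul' := fun x y => by ext; simp; rfl }
  have hact : ∀ (x : H) (v : Additive V), ((act x v).toMul : G) =
      x * (v.toMul : G) * (x : G)⁻¹ := fun x v => MulAut.conjNormal_apply _ _
  have hone : ∀ x, act x = 1 ↔ x ∈ Z := by
    intro x
    rw [h.mem_Z_iff]
    constructor
    · intro hx v hv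
      refine (hact x (Additive.ofMul ⟨v, hv⟩)).symm.trans ?_
      rw [hx]
      rfl
    · intro hx
      refine AddMonoidHom.ext fun v => ?_
      exact Additive.toMul.injective (Subtype.ext ((hact x v).trans (hx _ v.toMul.2)))
  have hcomm : ∀ x y : H, act x * act y = act y * act x ↔ ⁅x, y⁆ ∈ Z := by
    intro x y
    rw [← hone, commutatorElement_def, ← map_mul, ← map_mul]
    constructor
    · intro hxy
      rw [mul_assoc, ← mul_inv_rev, map_mul, hxy, ← map_mul, mul_inv_cancel, map_one]
    · intro hxy
      have h1 : x * y = (x * y * x⁻¹ * y⁻¹) * (y * x) := by group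
      rw [h1, map_mul, hxy, one_mul]
  obtain ⟨F, hF, hFf, j, Γ, hcard, hj, hΓj, hΓ, hΓc⟩ := exists_field_of_irreducible act K
    (fun k hk l hl => (hcomm k l).2 (h.quotient_comm (Subgroup.commutator_mem_commutator hk hl)))
    (fun B hB => by
      let W : Subgroup G := (AddSubgroup.toSubgroup' B).map V.subtype
      have hW : ∀ v : V, (v : G) ∈ W ↔ Additive.ofMul v ∈ B := fun v =>
        Subgroup.mem_map_iff_mem V.subtype_injective
      have hst : ∀ k ∈ K, ∀ w ∈ W, (k : G) * w * (k : G)⁻¹ ∈ W := by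
        intro k hk w' hw'
        obtain ⟨w, hw, hw'⟩ := Subgroup.mem_map.1 hw'
        rw [← hw']
        exact Subgroup.mem_map.2
          ⟨(act k (Additive.ofMul w)).toMul, hB k hk (Additive.ofMul w) hw, hact k _⟩
      rcases h.irreducible W (Subgroup.map_subtype_le _) hst with h0 | h0
      · left
        rw [AddSubgroup.eq_bot_iff_forall]
        intro v hv
        have : ((v.toMul : V) : G) ∈ W := (hW _).2 hv
        rw [h0, Subgroup.mem_bot] at this
        exact Additive.toMul.injective (Subtype.ext this)
      · right
        rw [AddSubgroup.eq_top_iff']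
        intro v
        refine (hW v.toMul).1 ?_
        rw [h0]
        exact v.toMul.2)
  -- Elements acting trivially on `F` commute as operators on `V`, so the kernel is commutative
  -- modulo `Z`.
  have hle : Γ.ker ≤ K := by
    apply h.le_K
    rw [Subgroup.commutator_le]
    exact fun x hx y hy => (hcomm x y).1 (hΓc x y hx hy)
  refine ⟨F, hF, hFf, j, Γ, hcard.trans h.card_V, fun k => (hj k).trans (hone k), hΓj,
    le_antisymm hle fun k hk => hΓ k fun l => ?_, fun x hx => hle (hΓ x hx)⟩
  · rw [hΓj k l ⟨k * l * k⁻¹, hK.conj_mem l l.2 k⟩ rfl]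
    have h1 : (⟨k * l * k⁻¹, hK.conj_mem l l.2 k⟩ : K) = ⁅(⟨k, hk⟩ : K), l⁆ * l := by
      refine Subtype.ext ?_
      simp [commutatorElement_def]
    rw [h1, map_mul, (hj _).2, one_mul]
    rw [hone]
    exact h.quotient_comm (Subgroup.commutator_mem_commutator hk l.2)

/-- `K` acts on `V` without fixed points modulo `Z`. -/
lemma eq_one_of_fixed (h : IsSemilinearProduct p m q V H Z K) {x : H} (hx : x ∈ K) (hxZ : x ∉ Z)
    {v : G} (hv : v ∈ V) (hfix : (x : G) * v * (x : G)⁻¹ = v) : v = 1 := by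
  have hV := h.normal
  let W : Subgroup G := V ⊓ Subgroup.centralizer {(x : G)}
  have hW : ∀ w, w ∈ W ↔ w ∈ V ∧ (x : G) * w * (x : G)⁻¹ = w := by
    intro w
    rw [Subgroup.mem_inf, Subgroup.mem_centralizer_singleton_iff, mul_inv_eq_iff_eq_mul, eq_comm]
  have hst : ∀ k ∈ K, ∀ w ∈ W, (k : G) * w * (k : G)⁻¹ ∈ W := by
    intro k hk w hw
    rw [hW] at hw ⊢
    refine ⟨hV.conj_mem w hw.1 k, ?_⟩
    have hz : ⁅k⁻¹, x⁆ ∈ Z :=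
      h.quotient_comm (Subgroup.commutator_mem_commutator (K.inv_mem hk) hx)
    have h1 := h.mem_Z_iff.1 hz w hw.1
    rw [commutatorElement_def, inv_inv] at h1
    push_cast at h1
    have h2 : (k : G)⁻¹ * x * k * w * ((k : G)⁻¹ * x * k)⁻¹ = w := by
      calc (k : G)⁻¹ * x * k * w * ((k : G)⁻¹ * x * k)⁻¹
          = (k : G)⁻¹ * x * k * (x : G)⁻¹ * (x * w * (x : G)⁻¹) *
            ((k : G)⁻¹ * x * k * (x : G)⁻¹)⁻¹ := by group
        _ = w := by rw [hw.2, h1]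
    calc (x : G) * (k * w * (k : G)⁻¹) * (x : G)⁻¹
        = k * ((k : G)⁻¹ * x * k * w * ((k : G)⁻¹ * x * k)⁻¹) * (k : G)⁻¹ := by group
      _ = _ := by rw [h2]
  rcases h.irreducible W inf_le_left hst with h0 | h0
  · exact Subgroup.mem_bot.1 (h0 ▸ (hW v).2 ⟨hv, hfix⟩)
  · refine absurd (h.mem_Z_iff.2 fun w hw => ?_) hxZ
    rw [← h0] at hw
    exact ((hW w).1 hw).2

/-- The projection onto the complement. -/
lemma exists_projection (h : IsSemilinearProduct p m q V H Z K) :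
    ∃ π : G →* H, π.ker = V ∧ ∀ x : H, π x = x := by
  have := h.normal
  let e := h.complement.symm.QuotientMulEquiv
  refine ⟨e.toMonoidHom.comp (QuotientGroup.mk' V), ?_, fun x => ?_⟩
  · ext g
    rw [MonoidHom.mem_ker, MonoidHom.comp_apply]
    change e _ = 1 ↔ _
    rw [e.map_eq_one_iff]
    exact QuotientGroup.eq_one_iff g
  · change e _ = x
    rw [← e.eq_symm_apply]
    rfl

/-- There is a degree divisible by all prime divisors of `m`. -/
lemma exists_degree_index [Finite G] (h : IsSemilinearProduct p m q V H Z K) :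
    ∃ d ∈ cd G, ∀ r, r.Prime → r ∣ m → r ∣ d := by
  have hK := h.K_normal
  obtain ⟨F, _, _, j, Γ, -, -, hΓ, -, hΓc⟩ := h.exists_field
  obtain ⟨ι, hι⟩ := exists_injective_unitsHom F
  obtain ⟨π, -, hπ⟩ := h.exists_projection
  -- This character of `K` has kernel exactly `Z`. An element fixing it acts trivially on `K / Z`,
  -- so it lies in `K`.
  obtain ⟨d, hd, hdeg⟩ := Clifford.exists_degree_over_linear (ι.comp j)
  refine ⟨d, Clifford.cd_subset_of_surjective (f := π) (fun x => ⟨x, hπ x⟩) hd, fun r hr hrm => ?_⟩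
  by_contra hrd
  rw [h.m_eq, ← Subgroup.relIndex_top_right] at hrm
  obtain ⟨x, -, hxK, k, hx⟩ := exists_prime_pow_eq_one_of_dvd_relIndex hr hrm
  obtain ⟨g, hg⟩ := hdeg r k hr hrd x (hx ▸ K.one_mem)
  apply hxK
  have hmem : g * x * g⁻¹ ∈ K := hΓc _ fun k => by
    have hl := hK.conj_mem k k.2 (g * x * g⁻¹)
    rw [hΓ (g * x * g⁻¹) k ⟨_, hl⟩ rfl]
    exact congrArg Units.val (hι (hg k ⟨_, hl⟩ rfl))
  simpa [mul_assoc] using hK.conj_mem _ hmem g⁻¹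

/-- `H / K` embeds in the cyclic automorphism group of a finite field. -/
lemma commutator_le_K [Finite G] (h : IsSemilinearProduct p m q V H Z K) : commutator H ≤ K := by
  obtain ⟨F, _, _, j, Γ, -, -, -, hker, -⟩ := h.exists_field
  have := isCyclic_ringAut F
  rw [← hker]
  let _ : CommGroup (F ≃+* F) := IsCyclic.commGroup
  rw [commutator_def, Subgroup.commutator_le]
  intro x _ y _
  rw [MonoidHom.mem_ker, map_commutatorElement, commutatorElement_eq_one_iff_mul_comm]
  exact mul_comm (Γ x) (Γ y)

/-- The preimage of `Z` in the semidirect product is abelian. -/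
lemma comm_of_mem_comap (h : IsSemilinearProduct p m q V H Z K) {π : G →* H} (hker : π.ker = V)
    (hπ : ∀ x : H, π x = x) {a b : G} (ha : a ∈ Z.comap π) (hb : b ∈ Z.comap π) :
    a * b = b * a := by
  have hdec : ∀ a, a * (π a : G)⁻¹ ∈ V := fun a => by
    rw [← hker, MonoidHom.mem_ker, map_mul, map_inv, hπ, mul_inv_cancel]
  have hcen : ∀ z ∈ Z, ∀ v ∈ V, (z : G) * v = v * z := fun z hz v hv =>
    mul_inv_eq_iff_eq_mul.1 (h.mem_Z_iff.1 hz v hv)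
  have hz : (π a : G) * π b = π b * π a := by
    have := Subgroup.mem_center_iff.1 (h.Z_le_center ha) (π b)
    exact congrArg Subtype.val this.symm
  have h1 := h.comm _ (hdec a) _ (hdec b)
  have h2 := hcen _ ha _ (hdec b)
  have h3 := hcen _ hb _ (hdec a)
  calc a * b = (a * (π a : G)⁻¹) * (π a * (b * (π b : G)⁻¹)) * π b := by group
    _ = (a * (π a : G)⁻¹) * (b * (π b : G)⁻¹) * (π a * π b) := by rw [h2]; group
    _ = (b * (π b : G)⁻¹) * ((a * (π a : G)⁻¹) * π b) * π a := by rw [h1, hz]; group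
    _ = b * a := by rw [← h3]; group

/-- There is a degree divisible by all prime divisors of `|K : Z|`. -/
lemma exists_degree_relIndex [Finite G] (h : IsSemilinearProduct p m q V H Z K) :
    ∃ d ∈ cd G, ∀ s, s.Prime → s ∣ Z.relIndex K → s ∣ d := by
  have hV := h.normal
  have hZ := Subgroup.normal_of_le_center h.Z_le_center
  obtain ⟨π, hker, hπ⟩ := h.exists_projection
  have hVM : V ≤ Z.comap π := hker ▸ Subgroup.ker_le_comap π Z
  obtain ⟨v₀, hv₀, hne⟩ := V.bot_or_exists_ne_one.resolve_left h.ne_bot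
  have hM : ⁅Z.comap π, Z.comap π⁆ ≤ ⊥ := by
    rw [Subgroup.commutator_le]
    intro a ha b hb
    rw [Subgroup.mem_bot, commutatorElement_eq_one_iff_mul_comm]
    exact h.comm_of_mem_comap hker hπ ha hb
  obtain ⟨χ, -, hχ⟩ := Clifford.exists_linear_apply_ne_one hM (hVM hv₀) (by simpa using hne)
  obtain ⟨d, hd, hdeg⟩ := Clifford.exists_degree_over_linear χ
  refine ⟨d, hd, fun s hs hsa => ?_⟩
  by_contra hsd
  obtain ⟨x, hxK, hxZ, k, hx⟩ := exists_prime_pow_eq_one_of_dvd_relIndex hs hsa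
  have hxG : (x : G) ^ s ^ k ∈ Z.comap π := by
    rw [← Subgroup.coe_pow, hx]
    exact Subgroup.one_mem _
  obtain ⟨g, hg⟩ := hdeg s k hs hsd x hxG
  set c : G := g * x * g⁻¹ with hc
  have hfree : ∀ v ∈ V, c * v * c⁻¹ = v → v = 1 := by
    intro v hv hcv
    have h1 : (x : G) * (g⁻¹ * v * g) * (x : G)⁻¹ = g⁻¹ * v * g := by
      calc (x : G) * (g⁻¹ * v * g) * (x : G)⁻¹ = g⁻¹ * (c * v * c⁻¹) * g := by rw [hc]; group
        _ = _ := by rw [hcv]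
    have h2 := h.eq_one_of_fixed hxK hxZ (by simpa using hV.conj_mem v hv g⁻¹) h1
    calc v = g * (g⁻¹ * v * g) * g⁻¹ := by group
      _ = 1 := by rw [h2]; group
  -- Since `c` has no nontrivial fixed point on `V`, every element of `V` is a commutator of `c`
  -- with an element of `V`. A `c`-invariant `χ` would then be trivial on `V`.
  let f : V → V := fun v => ⟨c * v * c⁻¹ * (v : G)⁻¹,
    V.mul_mem (hV.conj_mem v v.2 c) (V.inv_mem v.2)⟩
  have hinj : Function.Injective f := by
    intro v w hvw
    have h1 : c * v * c⁻¹ * (v : G)⁻¹ = c * w * c⁻¹ * (w : G)⁻¹ := congrArg Subtype.val hvw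
    have hcw := hV.conj_mem w w.2 c
    have h3 : c * ((w : G)⁻¹ * v) * c⁻¹ = (w : G)⁻¹ * v := by
      calc c * ((w : G)⁻¹ * v) * c⁻¹
          = (c * w * c⁻¹)⁻¹ * (c * v * c⁻¹ * (v : G)⁻¹) * v := by group
        _ = (w : G)⁻¹ * v := by rw [h1]; group
    have h4 := hfree _ (V.mul_mem (V.inv_mem w.2) v.2) h3
    exact Subtype.ext (inv_mul_eq_one.1 h4).symm
  obtain ⟨v, hv⟩ := (Finite.injective_iff_surjective.1 hinj) ⟨v₀, hv₀⟩
  apply hχ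
  have h5 : (⟨v₀, hVM hv₀⟩ : Z.comap π) =
      ⟨c * v * c⁻¹, hVM (hV.conj_mem v v.2 c)⟩ * (⟨v, hVM v.2⟩ : Z.comap π)⁻¹ :=
    Subtype.ext (congrArg Subtype.val hv).symm
  rw [h5, map_mul, map_inv, hg ⟨v, hVM v.2⟩ ⟨c * v * c⁻¹, _⟩ rfl, mul_inv_cancel]

/-- Every prime divisor of a degree divides `m` or `|K : Z|`. -/
lemma dvd_or_dvd_of_mem_cd [Finite G] (h : IsSemilinearProduct p m q V H Z K) {d r : ℕ}
    (hd : d ∈ cd G) (hr : r.Prime) (hrd : r ∣ d) : r ∣ m ∨ r ∣ Z.relIndex K := by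
  have hK := h.K_normal
  have hZ := Subgroup.normal_of_le_center h.Z_le_center
  obtain ⟨π, hker, hπ⟩ := h.exists_projection
  have hsurj : Function.Surjective π := fun x => ⟨x, hπ x⟩
  have h1 := Clifford.prime_dvd_of_mem_cd (M := Z.comap π) (E := K.comap π)
    (Subgroup.map_le_iff_le_comap.1 ?_) ?_ (Subgroup.comap_mono h.Z_le_K)
    (fun a ha b hb => h.comm_of_mem_comap hker hπ ha hb) hd hr hrd
  · rwa [Subgroup.index_comap_of_surjective _ hsurj, Subgroup.relIndex_comap,
      Subgroup.map_comap_eq_self_of_surjective hsurj, ← h.m_eq] at h1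
  · refine le_trans ?_ h.commutator_le_K
    rw [commutator_def, Subgroup.map_commutator, commutator_def]
    exact Subgroup.commutator_mono le_top le_top
  · rw [← Subgroup.map_le_iff_le_comap, Subgroup.map_commutator,
      Subgroup.map_comap_eq_self_of_surjective hsurj]
    exact h.quotient_comm

end IsSemilinearProduct

end DegreeGraph

/-! ### Centralised primary parts of `K / Z`. -/

namespace DegreeGraph

/-- The `r`-elements of `H / K` act trivially on the `s`-elements of `K / Z`. -/
def PrimaryPartsCommute {H : Type*} [Group H] (Z K : Subgroup H) (r s : ℕ) : Prop :=
  ∀ x, ∀ y ∈ K, ∀ k i, x ^ r ^ k ∈ K → y ^ s ^ i ∈ Z → ⁅x, y⁆ ∈ Z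

namespace IsSemilinearProduct

variable {G : Type*} [Group G] {p m q : ℕ} {V H : Subgroup G} {Z K : Subgroup H}

lemma two_le_q [Finite G] (h : IsSemilinearProduct p m q V H Z K) : 2 ≤ q := by
  obtain ⟨f, rfl⟩ := h.q_eq
  rcases Nat.eq_zero_or_pos f with rfl | hf
  · refine absurd (Subgroup.card_eq_one.1 ?_) h.ne_bot
    rw [h.card_V, pow_zero, one_pow]
  · exact h.prime.two_le.trans (Nat.le_self_pow hf.ne' p)

/-- The Sylow subgroups of `H / K` do not centralise the primary parts of `K / Z` in such a way
that each primary part is centralised by a Sylow `r₁`-subgroup or by a complement of it. -/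
theorem false_of_primaryPartsCommute [Finite G] (h : IsSemilinearProduct p m q V H Z K)
    {r₁ r₂ : ℕ} (hr₁ : r₁.Prime) (hr₂ : r₂.Prime) (hne : r₁ ≠ r₂) (h₁ : r₁ ∣ m) (h₂ : r₂ ∣ m)
    (hc : ∀ s, s.Prime → s ∣ Z.relIndex K → PrimaryPartsCommute Z K r₁ s ∨
      ∀ r, r.Prime → r ∣ m → r ≠ r₁ → PrimaryPartsCommute Z K r s) : False := by
  have hK := h.K_normal
  obtain ⟨F, _, _, j, Γ, hcard, hj, hΓ, hker, -⟩ := h.exists_field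
  have hm : m ≠ 0 := (zero_lt_one.trans h.one_lt_m).ne'
  -- The coprime factors are the `r₁`-part of `m` and its complement, which exceeds 1 because of
  -- `r₂`.
  have hxy : ordProj[r₁] m * ordCompl[r₁] m = m := Nat.ordProj_mul_ordCompl_eq_self m r₁
  have hcop : (ordProj[r₁] m).Coprime (ordCompl[r₁] m) :=
    (Nat.coprime_ordCompl hr₁ hm).pow_left _
  have hrange : Nat.card j.range = Z.relIndex K := by
    rw [← Subgroup.index_ker, Subgroup.relIndex]
    congr 1
    ext k
    rw [MonoidHom.mem_ker, hj, Subgroup.mem_subgroupOf]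
  have hr₁x : r₁ ∣ ordProj[r₁] m := dvd_pow_self r₁ (hr₁.factorization_pos_of_dvd hm h₁).ne'
  have hr₂y : r₂ ∣ ordCompl[r₁] m := by
    rw [← hxy] at h₂
    refine (hr₂.dvd_mul.1 h₂).resolve_left fun h0 => ?_
    exact hne ((Nat.prime_dvd_prime_iff_eq hr₂ hr₁).1 (hr₂.dvd_of_dvd_pow h0)).symm
  have hfix : ∀ s n, n ≠ 0 → (∀ r, r.Prime → r ∣ n → PrimaryPartsCommute Z K r s) →
      ∀ x : H, x ^ n ∈ K → ∀ k i, j k ^ s ^ i = 1 → Γ x (j k) = j k := by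
    intro s n hn hrs x hx k i hki
    let T : Subgroup H := (MulAction.stabilizer (F ≃+* F) ((j k : Fˣ) : F)).comap Γ
    have hKT : K ≤ T := by
      rw [← hker]
      exact Subgroup.ker_le_comap Γ _
    refine mem_of_primary_powers_mem hKT hn hx fun r l i' hr hrn hmem => ?_
    change Γ (x ^ i') (j k) = j k
    rw [hΓ _ k ⟨_, hK.conj_mem k k.2 (x ^ i')⟩ rfl]
    have h1 : ⁅x ^ i', (k : H)⁆ ∈ Z := by
      refine hrs r hr hrn _ k k.2 l i hmem ?_
      rw [← map_pow, hj] at hki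
      exact hki
    have h2 : (⟨x ^ i' * k * (x ^ i')⁻¹, hK.conj_mem k k.2 (x ^ i')⟩ : K) =
        ⟨⁅x ^ i', (k : H)⁆, h.Z_le_K h1⟩ * k := by
      refine Subtype.ext ?_
      simp [commutatorElement_def]
    rw [h2, map_mul, (hj _).2 h1, one_mul]
  refine false_of_fixed_primary_parts j Γ hker h.two_le_q (x := ordProj[r₁] m)
    (y := ordCompl[r₁] m) (by rw [hxy, hcard]) (by rw [hxy, h.m_eq]) hcop
    (lt_of_lt_of_le hr₁.one_lt (Nat.le_of_dvd (Nat.ordProj_pos m r₁) hr₁x))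
    (lt_of_lt_of_le hr₂.one_lt (Nat.le_of_dvd (Nat.ordCompl_pos r₁ hm) hr₂y))
    (by rw [hxy, hrange]; exact h.dvd) fun s hs hsj => ?_
  rw [hrange] at hsj
  rcases hc s hs hsj with h0 | h0
  · refine Or.inl (hfix s _ (Nat.ordProj_pos m r₁).ne' fun r hr hrx => ?_)
    rw [(Nat.prime_dvd_prime_iff_eq hr hr₁).1 (hr.dvd_of_dvd_pow hrx)]
    exact h0
  · refine Or.inr (hfix s _ (Nat.ordCompl_pos r₁ hm).ne' fun r hr hry => ?_)
    refine h0 r hr (hry.trans (Nat.ordCompl_dvd m r₁)) ?_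
    rintro rfl
    exact Nat.not_dvd_ordCompl hr₁ hm hry

/-- If `V ⋊ H` is a quotient of `G`, the degrees of `G` restrict the action of `H / K`
on `K / Z`. -/
lemma primaryPartsCommute [Finite G] (h : IsSemilinearProduct p m q V H Z K)
    {Γ : Type*} [Group Γ] [Finite Γ] {f : Γ →* G} (hf : Function.Surjective f) {d u r s : ℕ}
    (hd : d ∈ cd Γ) (hu : u.Prime) (hr : r.Prime) (hs : s.Prime) (hud : u ∣ d) (hum : ¬ u ∣ m)
    (hsd : ¬ s ∣ d) (hur : ∀ d' ∈ cd Γ, u ∣ d' → ¬ r ∣ d') : PrimaryPartsCommute Z K r s := by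
  have hK := h.K_normal
  have hZ := Subgroup.normal_of_le_center h.Z_le_center
  obtain ⟨π, -, hπ⟩ := h.exists_projection
  let φ : Γ →* H := π.comp f
  have hsurj : Function.Surjective π := fun x => ⟨x, hπ x⟩
  have hφ : Function.Surjective φ := hsurj.comp hf
  intro x y hy k i hx hyZ
  obtain ⟨x, rfl⟩ := hφ x
  obtain ⟨y, rfl⟩ := hφ y
  have h1 := Clifford.commutator_mem_of_not_dvd (M := Z.comap φ) (E := K.comap φ) ?_ ?_ hd hu hr hs
    hud (by rwa [Subgroup.index_comap_of_surjective _ hφ, ← h.m_eq]) hsd hur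
    (x := x) (y := y) (k := k) (j := i) (by simpa using hx) hy (by simpa using hyZ)
  · rwa [Subgroup.mem_comap, map_commutatorElement] at h1
  · rw [← Subgroup.map_le_iff_le_comap]
    refine le_trans ?_ h.commutator_le_K
    rw [commutator_def, Subgroup.map_commutator, commutator_def]
    exact Subgroup.commutator_mono le_top le_top
  · rw [← Subgroup.map_le_iff_le_comap, Subgroup.map_commutator,
      Subgroup.map_comap_eq_self_of_surjective hφ]
    exact h.quotient_comm

end IsSemilinearProduct

end DegreeGraph

/-! ### Contradiction from the neighbours of `p₁` and `p₂`. -/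

namespace DegreeGraph

/-- Let `V ⋊ H` be a quotient of `Γ`, and let `p₁`, `p₂` be the prime divisors of `m` or those of
`|K : Z|`. Then `p₁` and `p₂` do not each have exactly one neighbour `q₁ ≠ q₂` outside of
`{p₁, p₂}` in the degree graph of `Γ`. -/
theorem IsSemilinearProduct.false_of_neighbors {G : Type*} [Group G] [Finite G] {p m q : ℕ}
    {V H : Subgroup G} {Z K : Subgroup H} (h : IsSemilinearProduct p m q V H Z K)
    {Γ : Type*} [Group Γ] [Finite Γ] {f : Γ →* G} (hf : Function.Surjective f)
    {p₁ p₂ q₁ q₂ : ℕ} (hp₁ : p₁.Prime) (hp₂ : p₂.Prime) (hq₁ : q₁.Prime) (hq₂ : q₂.Prime)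
    (hp : p₁ ≠ p₂) (hq : q₁ ≠ q₂) (hq₁' : q₁ ≠ p₁ ∧ q₁ ≠ p₂) (hq₂' : q₂ ≠ p₁ ∧ q₂ ≠ p₂)
    (had₁ : ∃ d ∈ cd Γ, p₁ ∣ d ∧ q₁ ∣ d) (had₂ : ∃ d ∈ cd Γ, p₂ ∣ d ∧ q₂ ∣ d)
    (hnb₁ : ∀ r, r.Prime → ∀ d ∈ cd Γ, p₁ ∣ d → r ∣ d → r = p₁ ∨ r = p₂ ∨ r = q₁)
    (hnb₂ : ∀ r, r.Prime → ∀ d ∈ cd Γ, p₂ ∣ d → r ∣ d → r = p₁ ∨ r = p₂ ∨ r = q₂)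
    (hqma₁ : q₁ ∣ m ∨ q₁ ∣ Z.relIndex K) (hqma₂ : q₂ ∣ m ∨ q₂ ∣ Z.relIndex K)
    (hcase : (∀ r, r.Prime → (r ∣ m ↔ r = p₁ ∨ r = p₂)) ∨
      ∀ r, r.Prime → (r ∣ Z.relIndex K ↔ r = p₁ ∨ r = p₂)) : False := by
  have hcop : ∀ r, r.Prime → r ∣ m → r ∣ Z.relIndex K → False := fun r hr h₁ h₂ =>
    hr.one_lt.ne' (Nat.eq_one_of_dvd_coprimes h.coprime h₁ h₂)
  have hnot₁ : ∀ d ∈ cd Γ, p₁ ∣ d → ¬ q₂ ∣ d := fun d hd h₁ h₂ => by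
    rcases hnb₁ q₂ hq₂ d hd h₁ h₂ with h0 | h0 | h0
    exacts [hq₂'.1 h0, hq₂'.2 h0, hq h0.symm]
  have hnot₂ : ∀ d ∈ cd Γ, p₂ ∣ d → ¬ q₁ ∣ d := fun d hd h₁ h₂ => by
    rcases hnb₂ q₁ hq₁ d hd h₁ h₂ with h0 | h0 | h0
    exacts [hq₁'.1 h0, hq₁'.2 h0, hq h0]
  obtain ⟨d₁, hd₁, hpd₁, hqd₁⟩ := had₁
  obtain ⟨d₂, hd₂, hpd₂, hqd₂⟩ := had₂
  rcases hcase with hm | ha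
  · have hp₁m := (hm p₁ hp₁).2 (Or.inl rfl)
    have hp₂m := (hm p₂ hp₂).2 (Or.inr rfl)
    have hq₁m : ¬ q₁ ∣ m := fun h0 => ((hm q₁ hq₁).1 h0).elim hq₁'.1 hq₁'.2
    have hq₂m : ¬ q₂ ∣ m := fun h0 => ((hm q₂ hq₂).1 h0).elim hq₂'.1 hq₂'.2
    refine h.false_of_primaryPartsCommute hp₁ hp₂ hp hp₁m hp₂m fun s hs hsa => ?_
    -- For `s = q₂` the degree `d₁` avoids `s`, and `q₁`, `p₂` are not adjacent, so `p₂`-elements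
    -- act trivially. For other `s` the degree `d₂` avoids `s`, and `q₂`, `p₁` are not adjacent, so
    -- `p₁`-elements do.
    by_cases hsq : s = q₂
    · subst hsq
      refine Or.inr fun r hr hrm hrp => ?_
      obtain rfl := ((hm r hr).1 hrm).resolve_left hrp
      exact h.primaryPartsCommute hf hd₁ hq₁ hr hs hqd₁ hq₁m (hnot₁ d₁ hd₁ hpd₁)
        fun d hd h₁ h₂ => hnot₂ d hd h₂ h₁
    · refine Or.inl (h.primaryPartsCommute hf hd₂ hq₂ hp₁ hs hqd₂ hq₂m (fun hsd => ?_)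
        fun d hd h₁ h₂ => hnot₁ d hd h₂ h₁)
      rcases hnb₂ s hs d₂ hd₂ hpd₂ hsd with rfl | rfl | h0
      exacts [hcop _ hs hp₁m hsa, hcop _ hs hp₂m hsa, hsq h0]
  · have hp₁a := (ha p₁ hp₁).2 (Or.inl rfl)
    have hp₂a := (ha p₂ hp₂).2 (Or.inr rfl)
    have hq₁m : q₁ ∣ m := hqma₁.resolve_right fun h0 =>
      ((ha q₁ hq₁).1 h0).elim hq₁'.1 hq₁'.2
    have hq₂m : q₂ ∣ m := hqma₂.resolve_right fun h0 =>
      ((ha q₂ hq₂).1 h0).elim hq₂'.1 hq₂'.2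
    refine h.false_of_primaryPartsCommute hq₁ hq₂ hq hq₁m hq₂m fun s hs hsa => ?_
    -- Now `m` may have many primes. The `p₁`-part is centralised by `q₁`-elements, as `q₁` and `p₂`
    -- are not adjacent; the `p₂`-part by `r`-elements for every other prime `r` of `m`, as `p₁` has
    -- no neighbour dividing `m` but `q₁`.
    rcases (ha s hs).1 hsa with rfl | rfl
    · exact Or.inl (h.primaryPartsCommute hf hd₂ hp₂ hq₁ hs hpd₂ (fun h0 => hcop _ hp₂ h0 hp₂a)
        (fun h0 => hnot₁ d₂ hd₂ h0 hqd₂) hnot₂)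
    · refine Or.inr fun r hr hrm hrq => ?_
      refine h.primaryPartsCommute hf hd₁ hp₁ hr hs hpd₁ (fun h0 => hcop _ hp₁ h0 hp₁a)
        (fun h0 => hnot₂ d₁ hd₁ h0 hqd₁) fun d hd h₁ h₂ => ?_
      rcases hnb₁ r hr d hd h₁ h₂ with rfl | rfl | h0
      exacts [hcop _ hr hrm hp₁a, hcop _ hr hrm hp₂a, hrq h0]

/-- The primes dividing a common degree lie in one component of the degree graph. -/
lemma mem_of_mem_components {G : Type*} [Group G] {C : Set ℕ} (hC : C ∈ components G) {r s d : ℕ}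
    (hr : r.Prime) (hs : s.Prime) (hd : d ∈ cd G) (hrd : r ∣ d) (hsd : s ∣ d) (hrC : r ∈ C) :
    s ∈ C := by
  by_cases hrs : r = s
  · exact hrs ▸ hrC
  obtain ⟨c, rfl⟩ := hC
  obtain ⟨v, hv, rfl⟩ := hrC
  refine ⟨⟨s, hs, d, hd, hsd⟩, ?_, rfl⟩
  have hadj : (degreeGraph G).Adj v ⟨s, hs, d, hd, hsd⟩ :=
    ⟨fun h0 => hrs (congrArg Subtype.val h0), d, hd,
      ((Nat.coprime_primes hr hs).2 hrs).mul_dvd_of_dvd_of_dvd hrd hsd⟩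
  exact (c.mem_supp_congr_adj hadj).1 hv

end DegreeGraph

open DegreeGraph in
theorem lemma2p5 {G : Type*} [Group G] [Finite G] [Group.IsSolvable G] (N : Subgroup G) [N.Normal]
    (hrho : DegreeGraph.rho (G ⧸ N) = DegreeGraph.rho G)
    (htype : DegreeGraph.IsSemilinearType (G ⧸ N))
    (p₁ p₂ : DegreeGraph.rho G) (hne : p₁ ≠ p₂)
    (hcomp : DegreeGraph.components (G ⧸ N) =
      {{(p₁ : ℕ), (p₂ : ℕ)}, DegreeGraph.rho G \ {(p₁ : ℕ), (p₂ : ℕ)}})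
    (hdeg₁ : ((DegreeGraph.degreeGraph G).neighborSet p₁).ncard = 2)
    (hdeg₂ : ((DegreeGraph.degreeGraph G).neighborSet p₂).ncard = 2)
    (hcommon : (DegreeGraph.degreeGraph G).commonNeighbors p₁ p₂ = ∅) :
    N = ⊥ := by
  -- `N = ⊥` would make `{p₁, p₂}` a component of `Δ(G)`, against the degrees of `p₁` and `p₂`.
  -- So the claim is that no such `G` and `N` exist, which is what we prove.
  exfalso
  obtain ⟨p, m, q, V, H, Z, K, h⟩ := htype
  have hsurj : Function.Surjective (QuotientGroup.mk' N) := QuotientGroup.mk'_surjective N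
  have hcd : cd (G ⧸ N) ⊆ cd G := Clifford.cd_subset_of_surjective hsurj
  have hp₁ := p₁.2.1
  have hp₂ := p₂.2.1
  have hne' : (p₁ : ℕ) ≠ p₂ := fun h0 => hne (Subtype.ext h0)
  have hC : ({(p₁ : ℕ), (p₂ : ℕ)} : Set ℕ) ∈ components (G ⧸ N) := by
    rw [hcomp]; exact Set.mem_insert _ _
  have hma : ∀ r ∈ rho G, r ∣ m ∨ r ∣ Z.relIndex K := by
    intro r hr
    rw [← hrho] at hr
    obtain ⟨hr, d, hd, hrd⟩ := hr
    exact h.dvd_or_dvd_of_mem_cd hd hr hrd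
  have hadj : ∀ a b : rho G, (degreeGraph G).Adj a b ↔
      a ≠ b ∧ ∃ d ∈ cd G, (a : ℕ) ∣ d ∧ (b : ℕ) ∣ d := by
    intro a b
    refine and_congr_right fun hab => exists_congr fun d => and_congr_right fun _ => ?_
    have hcop := (Nat.coprime_primes a.2.1 b.2.1).2 fun h0 => hab (Subtype.ext h0)
    exact ⟨fun h0 => ⟨(Nat.dvd_mul_right _ _).trans h0, (Nat.dvd_mul_left _ _).trans h0⟩,
      fun h0 => hcop.mul_dvd_of_dvd_of_dvd h0.1 h0.2⟩
  have houter : ∀ a b : rho G, ((degreeGraph G).neighborSet a).ncard = 2 →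
      ∃ c, c ≠ b ∧ (degreeGraph G).Adj a c := by
    intro a b hab
    obtain ⟨x, y, hxy, hset⟩ := Set.ncard_eq_two.1 hab
    have hx : x ∈ (degreeGraph G).neighborSet a := hset ▸ Set.mem_insert _ _
    have hy : y ∈ (degreeGraph G).neighborSet a := hset ▸ Set.mem_insert_of_mem _ rfl
    by_cases hxb : x = b
    · exact ⟨y, fun h0 => hxy (hxb.trans h0.symm), hy⟩
    · exact ⟨x, hxb, hx⟩
  obtain ⟨q₁, hq₁p₂, hq₁⟩ := houter p₁ p₂ hdeg₁
  obtain ⟨q₂, hq₂p₁, hq₂⟩ := houter p₂ p₁ hdeg₂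
  have hclique : ∀ n : ℕ, (∃ d ∈ cd (G ⧸ N), ∀ r, r.Prime → r ∣ n → r ∣ d) → (p₁ : ℕ) ∣ n →
      ∀ r, r.Prime → r ∣ n → r = p₁ ∨ r = p₂ := by
    rintro n ⟨d, hd, hdn⟩ hpn r hr hrn
    exact mem_of_mem_components hC hp₁ hr hd (hdn _ hp₁ hpn) (hdn r hr hrn) (Set.mem_insert _ _)
  have hclique' : ∀ n : ℕ, (∃ d ∈ cd (G ⧸ N), ∀ r, r.Prime → r ∣ n → r ∣ d) → (p₂ : ℕ) ∣ n →
      ∀ r, r.Prime → r ∣ n → r = p₁ ∨ r = p₂ := by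
    rintro n ⟨d, hd, hdn⟩ hpn r hr hrn
    exact mem_of_mem_components hC hp₂ hr hd (hdn _ hp₂ hpn) (hdn r hr hrn)
      (Set.mem_insert_of_mem _ rfl)
  have hpq₁ : (q₁ : ℕ) ≠ p₁ ∧ (q₁ : ℕ) ≠ p₂ :=
    ⟨fun h0 => hq₁.1 (Subtype.ext h0.symm), fun h0 => hq₁p₂ (Subtype.ext h0)⟩
  have hpq₂ : (q₂ : ℕ) ≠ p₁ ∧ (q₂ : ℕ) ≠ p₂ :=
    ⟨fun h0 => hq₂p₁ (Subtype.ext h0), fun h0 => hq₂.1 (Subtype.ext h0.symm)⟩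
  have hm := h.exists_degree_index
  have ha := h.exists_degree_relIndex
  -- If `p₁` and `p₂` were split between `n` and `n'`, both numbers would have prime divisors only
  -- in the component `{p₁, p₂}`, leaving no place for `q₁`.
  have hboth : ∀ n n' : ℕ, (∃ d ∈ cd (G ⧸ N), ∀ r, r.Prime → r ∣ n → r ∣ d) →
      (∃ d ∈ cd (G ⧸ N), ∀ r, r.Prime → r ∣ n' → r ∣ d) →
      (∀ r ∈ rho G, r ∣ n ∨ r ∣ n') → (p₁ : ℕ) ∣ n → (p₂ : ℕ) ∣ n := by
    intro n n' hn hn' hnn hpn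
    by_contra hpn'
    have h2 := hclique' n' hn' ((hnn _ p₂.2).resolve_left hpn')
    rcases hnn _ q₁.2 with h0 | h0
    · exact (hclique n hn hpn _ q₁.2.1 h0).elim hpq₁.1 hpq₁.2
    · exact (h2 _ q₁.2.1 h0).elim hpq₁.1 hpq₁.2
  have hcase : ∃ n : ℕ, (n = m ∨ n = Z.relIndex K) ∧
      (∃ d ∈ cd (G ⧸ N), ∀ r, r.Prime → r ∣ n → r ∣ d) ∧
      ∀ r, r.Prime → (r ∣ n ↔ r = p₁ ∨ r = p₂) := by
    rcases hma _ p₁.2 with h0 | h0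
    · have h2 := hboth m _ hm ha hma h0
      refine ⟨m, Or.inl rfl, hm, fun r hr => ⟨hclique m hm h0 r hr, ?_⟩⟩
      rintro (rfl | rfl) <;> assumption
    · have h2 := hboth _ m ha hm (fun r hr => (hma r hr).symm) h0
      refine ⟨_, Or.inr rfl, ha, fun r hr => ⟨hclique _ ha h0 r hr, ?_⟩⟩
      rintro (rfl | rfl) <;> assumption
  obtain ⟨n, hn, ⟨d, hd, hdn⟩, hiff⟩ := hcase
  have hp₁d := hdn _ hp₁ ((hiff _ hp₁).2 (Or.inl rfl))
  have hp₂d := hdn _ hp₂ ((hiff _ hp₂).2 (Or.inr rfl))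
  -- This edge uses up one of the two neighbours of each vertex, so `q₁` and `q₂` are the only
  -- others.
  have hp₁₂ : (degreeGraph G).Adj p₁ p₂ := (hadj _ _).2 ⟨hne, d, hcd hd, hp₁d, hp₂d⟩
  have hnbr : ∀ a b c : rho G, ((degreeGraph G).neighborSet a).ncard = 2 →
      (degreeGraph G).Adj a b → (degreeGraph G).Adj a c → b ≠ c →
      ∀ r, r.Prime → ∀ d ∈ cd G, (a : ℕ) ∣ d → r ∣ d → r = a ∨ r = b ∨ r = c := by
    intro a b c hcard hab hac hbc r hr d hd had hrd
    by_cases hra : r = a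
    · exact Or.inl hra
    have hmem : (⟨r, hr, d, hd, hrd⟩ : rho G) ∈ (degreeGraph G).neighborSet a :=
      (hadj _ _).2 ⟨fun h0 => hra (congrArg Subtype.val h0).symm, d, hd, had, hrd⟩
    have heq : ({b, c} : Set (rho G)) = (degreeGraph G).neighborSet a :=
      Set.eq_of_subset_of_ncard_le (Set.insert_subset hab (Set.singleton_subset_iff.2 hac))
        (by rw [hcard, Set.ncard_pair hbc])
        (Set.finite_of_ncard_ne_zero (by rw [hcard]; norm_num))
    rw [← heq] at hmem
    rcases hmem with h0 | h0
    · exact Or.inr (Or.inl (congrArg Subtype.val h0))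
    · exact Or.inr (Or.inr (congrArg Subtype.val h0))
  refine h.false_of_neighbors hsurj hp₁ hp₂ q₁.2.1 q₂.2.1 hne' (fun h0 => ?_) hpq₁ hpq₂
    ((hadj _ _).1 hq₁).2 ((hadj _ _).1 hq₂).2
    (hnbr p₁ p₂ q₁ hdeg₁ hp₁₂ hq₁ hq₁p₂.symm)
    (fun r hr d hd h₁ h₂ => ?_) (hma _ q₁.2) (hma _ q₂.2) ?_
  · have hmem : q₁ ∈ (degreeGraph G).commonNeighbors p₁ p₂ :=
      ⟨hq₁, (Subtype.ext h0 : q₁ = q₂) ▸ hq₂⟩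
    rw [hcommon] at hmem
    exact hmem
  · rcases hnbr p₂ p₁ q₂ hdeg₂ hp₁₂.symm hq₂ hq₂p₁.symm r hr d hd h₁ h₂ with h0 | h0 | h0
    exacts [Or.inr (Or.inl h0), Or.inl h0, Or.inr (Or.inr h0)]
  · rcases hn with rfl | rfl
    exacts [Or.inl hiff, Or.inr hiff]
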